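/- Let $(n_1,n_2)=(1,2)$ or $(n_1,n_2)=(2,n_2)$ with $n_2\ge 2$, and put $r=n_1+n_2-2$ and $\vec n=(4,\ldots,4)$ ($r$ entries). Let $\mathbf U$ be the Grover matrix of the complete bipartite graph $K_{n_1,n_2}$: its rows and columns are indexed by the arcs (oriented edges), and for arcs $e,f$ with $o(\cdot),t(\cdot)$ denoting origin and terminus, $U_{ef}=2/\deg t(f)$ if $t(f)=o(e)$ and $f\ne e^{-1}$, $U_{ef}=2/\deg t(f)-1$ if $f=e^{-1}$, and $U_{ef}=0$ otherwise. Let $\zeta_{\mathbf U}(u)=\det(\mathbf I-u\mathbf U)^{-1}$. For $f=\zeta_{\mathbf U}$ define the absolute Hurwitz zeta function and the absolute zeta function $$Z_f(w,s)=\frac1{\Gamma(w)}\int_1^\infty f(x)\,x^{-s-1}(\log x)^{w-1}\,dx,\qquad \zeta_f(s)=\exp\Big(\frac{\partial}{\partial w}Z_f(w,s)\Big|_{w=0}\Big),$$ where $Z_f$ is continued meromorphically in $w$ and $\zeta_f$ is continued meromorphically in $s$. For $\omega=(\omega_1,\dots,\omega_r)$ with positive entries let $$\zeta_r(w,x,\omega)=\sum_{k_1,\dots,k_r\ge0}(k_1\omega_1+\cdots+k_r\omega_r+x)^{-w},\qquad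 \Gamma_r(x,\omega)=\exp\Big(\frac{\partial}{\partial w}\zeta_r(w,x,\omega)\Big|_{w=0}\Big),$$ continued meromorphically in $w$ and in $x$ respectively, and let $S_r(x,\omega)=\Gamma_r(x,\omega)^{-1}\,\Gamma_r(\omega_1+\cdots+\omega_r-x,\omega)^{(-1)^r}$ be the multiple sine function. Then: (0) $\zeta_{\mathbf U}(u)=\dfrac{(-1)^{n_1+n_2}}{(u^4-1)^{r}}$ for all $u\in\mathbb C$ with $u^4\neq1$, and $f=\zeta_{\mathbf U}$ is an absolute automorphic form of weight $D=-4r$ with sign $C=(-1)^{n_1+n_2}$, i.e. $f(1/x)=C\,x^{-D}f(x)$ for real $x\ne0$. The integral defining $Z_f(w,s)$ converges absolutely for $\operatorname{Re}w>r$, $\operatorname{Re}s>-4r$, and the series $\zeta_r(w,x,\vec n)$ converges absolutely for $\operatorname{Re}w>r$, $\operatorname{Re}x>0$; for such fixed $s$ and $x$ both have meromorphic continuations to $w\in\mathbb C$ that are analytic at $w=0$, so that for $\operatorname{Re}s>-4r$ and $\operatorname{Re}x>0$ the formulas above define $\zeta_f(s)$ and $\Gamma_r(x,\vec n)$, and these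 two functions have meromorphic continuations to $\mathbb C$. (1) For $\operatorname{Re}s>-4r$ and all $w$, as meromorphic functions of $w\in\mathbb C$, $$Z_{\zeta_{\mathbf U}}(w,s)=(-1)^{n_1+n_2}\,\zeta_{r}\big(w,\;s+4r,\;\vec n\big).$$ (2) As meromorphic functions of $s\in\mathbb C$, $$\zeta_{\zeta_{\mathbf U}}(s)=\Gamma_{r}\big(s+4r,\;\vec n\big)^{(-1)^{n_1+n_2}}.$$ (3) As meromorphic functions of $s\in\mathbb C$ (in particular, at every $s\notin\{4k,\,-4(r+k): k=0,1,2,\dots\}$), $$\zeta_{\zeta_{\mathbf U}}(-4r-s)^{(-1)^{n_1+n_2}}=\varepsilon(s)\,\zeta_{\zeta_{\mathbf U}}(s),\qquad \varepsilon(s)=S_{r}\big(s+4r,\;\vec n\big)^{(-1)^{n_1+n_2}}.$$ -/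

import Mathlib

open scoped Matrix

/-! ### The Grover walk on a finite simple graph and its zeta function -/

section Grover

/-- The Grover matrix `U_G`, indexed by the arcs of `G`.  For arcs `e`, `f` the entry `U e f` is
`2 / deg t(f) - 1` if `f` is the inverse arc of `e`, it is `2 / deg t(f)` if `t(f) = o(e)` and
`f` is not the inverse of `e`, and it is `0` otherwise. -/
noncomputable def groverMatrix {V : Type*} [Fintype V] [DecidableEq V] (G : SimpleGraph V)
    [DecidableRel G.Adj] : Matrix G.Dart G.Dart ℝ :=
  Matrix.of fun e f =>
    if f = e.symm then 2 / (G.degree f.snd : ℝ) - 1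
    else if f.snd = e.fst then 2 / (G.degree f.snd : ℝ)
    else 0

/-- The zeta function `ζ_A(u) = det (I - u A)⁻¹` of a square matrix. -/
noncomputable def matrixZeta {ι : Type*} [Fintype ι] [DecidableEq ι] (A : Matrix ι ι ℂ) (u : ℂ) :
    ℂ :=
  (1 - u • A).det⁻¹

/-- The zeta function `ζ_{U_G}` of the Grover walk on `G`. -/
noncomputable def groverZeta {V : Type*} [Fintype V] [DecidableEq V] (G : SimpleGraph V)
    [DecidableRel G.Adj] (u : ℂ) : ℂ :=
  matrixZeta ((groverMatrix G).map (fun x : ℝ => (x : ℂ))) u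

end Grover

/-! ### Meromorphic continuation from a right half-plane -/

section Continuation

/-- `F` is the meromorphic continuation to `ℂ` of a function `g` given on a right half-plane:
`F` is meromorphic on `ℂ`, agrees with `g` on some half-plane `{c < re z}`, and its values are
the limits at the removable singularities and `0` at the poles (normal form). -/
def IsMeroCont (g F : ℂ → ℂ) : Prop :=
  MeromorphicNFOn F Set.univ ∧ ∃ c : ℝ, ∀ z : ℂ, c < z.re → F z = g z

/-- A meromorphic continuation is unique. -/
theorem IsMeroCont.unique {g F₁ F₂ : ℂ → ℂ} (h₁ : IsMeroCont g F₁) (h₂ : IsMeroCont g F₂) :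
    F₁ = F₂ := by
  obtain ⟨m₁, c₁, e₁⟩ := h₁
  obtain ⟨m₂, c₂, e₂⟩ := h₂
  have hm : MeromorphicOn (F₁ - F₂) Set.univ := m₁.meromorphicOn.sub m₂.meromorphicOn
  have hy : meromorphicOrderAt (F₁ - F₂) ((max c₁ c₂ + 1 : ℝ) : ℂ) = ⊤ := by
    rw [meromorphicOrderAt_eq_top_iff]
    have hopen : IsOpen {z : ℂ | max c₁ c₂ < z.re} :=
      isOpen_lt continuous_const Complex.continuous_re
    have hmem : ((max c₁ c₂ + 1 : ℝ) : ℂ) ∈ {z : ℂ | max c₁ c₂ < z.re} := by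
      rw [Set.mem_ofPred_eq, Complex.ofReal_re]
      exact lt_add_one _
    filter_upwards [mem_nhdsWithin_of_mem_nhds (hopen.mem_nhds hmem)] with z hz
    have hz' : max c₁ c₂ < z.re := hz
    simp [e₁ z (lt_of_le_of_lt (le_max_left _ _) hz'),
      e₂ z (lt_of_le_of_lt (le_max_right _ _) hz')]
  funext x
  have hx : meromorphicOrderAt (F₁ - F₂) x = ⊤ := by
    by_contra hne
    exact hm.meromorphicOrderAt_ne_top_of_isPreconnected (x := x) isPreconnected_univ
      (Set.mem_univ _) (Set.mem_univ _) hne hy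
  rw [meromorphicOrderAt_eq_top_iff] at hx
  have hxe : F₁ =ᶠ[nhdsWithin x {x}ᶜ] F₂ := by
    filter_upwards [hx] with z hz
    exact sub_eq_zero.mp hz
  exact ((m₁ (Set.mem_univ x)).eventuallyEq_nhdsNE_iff_eventuallyEq_nhds
    (m₂ (Set.mem_univ x))).mp hxe |>.eq_of_nhds

open Classical in
/-- The meromorphic continuation of `g` to `ℂ` from a right half-plane (the constant `0` if there
is none). -/
noncomputable def meroCont (g : ℂ → ℂ) : ℂ → ℂ :=
  if h : ∃ F, IsMeroCont g F then h.choose else 0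

end Continuation

/-! ### Multiple Hurwitz zeta, gamma and sine functions -/

section Multiple

/-- The general term `(n₁ ω₁ + ⋯ + n_r ω_r + x) ^ (-w)` of the multiple Hurwitz zeta series. -/
noncomputable def multipleHurwitzTerm {r : ℕ} (w x : ℂ) (ω : Fin r → ℝ) (n : Fin r → ℕ) : ℂ :=
  ((∑ i, (n i : ℂ) * (ω i : ℂ)) + x) ^ (-w)

/-- The multiple Hurwitz zeta function `ζ_r(w, x, ω)`: the multiple series, continued
meromorphically in `w`. -/
noncomputable def multipleHurwitz {r : ℕ} (w x : ℂ) (ω : Fin r → ℝ) : ℂ :=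
  meroCont (fun w' => ∑' n : Fin r → ℕ, multipleHurwitzTerm w' x ω n) w

/-- The multiple gamma function `Γ_r(x, ω) = exp (∂/∂w ζ_r(w, x, ω) at w = 0)`, continued
meromorphically in `x`. -/
noncomputable def multipleGamma {r : ℕ} (x : ℂ) (ω : Fin r → ℝ) : ℂ :=
  meroCont (fun x' => Complex.exp (deriv (fun w => multipleHurwitz w x' ω) 0)) x

/-- The multiple sine function
`S_r(x, ω) = Γ_r(x, ω)⁻¹ Γ_r(ω₁ + ⋯ + ω_r - x, ω) ^ ((-1) ^ r)`. -/
noncomputable def multipleSine {r : ℕ} (x : ℂ) (ω : Fin r → ℝ) : ℂ :=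
  (multipleGamma x ω)⁻¹ * multipleGamma ((∑ i, (ω i : ℂ)) - x) ω ^ ((-1 : ℤ) ^ r)

end Multiple

/-! ### Absolute automorphic forms, absolute Hurwitz zeta and absolute zeta functions -/

section Absolute

/-- `f` is an absolute automorphic form of weight `D` with sign `C`: `f(1/x) = C x^(-D) f(x)`.
A pole of `f` is recorded by the value `0`. -/
def IsAbsoluteAutomorphicForm (f : ℝ → ℂ) (C D : ℤ) : Prop :=
  (C = 1 ∨ C = -1) ∧ ∀ x : ℝ, x ≠ 0 → f (1 / x) = (C : ℂ) * (x : ℂ) ^ (-D) * f x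

/-- The integrand `f(x) x^(-s-1) (log x)^(w-1)` of the absolute Hurwitz zeta function. -/
noncomputable def absHurwitzIntegrand (f : ℝ → ℂ) (w s : ℂ) (x : ℝ) : ℂ :=
  f x * (x : ℂ) ^ (-s - 1) * (Real.log x : ℂ) ^ (w - 1)

/-- The integral `Γ(w)⁻¹ ∫_1^∞ f(x) x^(-s-1) (log x)^(w-1) dx`. -/
noncomputable def absHurwitzIntegral (f : ℝ → ℂ) (w s : ℂ) : ℂ :=
  (Complex.Gamma w)⁻¹ * ∫ x in Set.Ioi (1 : ℝ), absHurwitzIntegrand f w s x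

/-- The absolute Hurwitz zeta function `Z_f(w, s)`: the integral, continued meromorphically
in `w`. -/
noncomputable def absHurwitz (f : ℝ → ℂ) (w s : ℂ) : ℂ :=
  meroCont (fun w' => absHurwitzIntegral f w' s) w

/-- The absolute zeta function `ζ_f(s) = exp (∂/∂w Z_f(w, s) at w = 0)`, continued
meromorphically in `s`. -/
noncomputable def absZeta (f : ℝ → ℂ) (s : ℂ) : ℂ :=
  meroCont (fun s' => Complex.exp (deriv (fun w => absHurwitz f w s') 0)) s

end Absolute

/-- Adjacency in a complete bipartite graph is decidable. -/
instance completeBipartiteGraphDecidableAdj (n₁ n₂ : ℕ) :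
    DecidableRel (completeBipartiteGraph (Fin n₁) (Fin n₂)).Adj := fun v w =>
  inferInstanceAs (Decidable (v.isLeft ∧ w.isRight ∨ v.isRight ∧ w.isLeft))

/-- The zeta function of the Grover walk on the complete bipartite graph `K_{n₁,n₂}`. -/
noncomputable def bipartiteGroverZeta (n₁ n₂ : ℕ) (u : ℂ) : ℂ :=
  groverZeta (completeBipartiteGraph (Fin n₁) (Fin n₂)) u

/-- The same function of a real variable. -/
noncomputable def bipartiteForm (n₁ n₂ : ℕ) (x : ℝ) : ℂ :=
  bipartiteGroverZeta n₁ n₂ (x : ℂ)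

/-- The factor `ε(s) = S_r(s + 4 r, (4, …, 4)) ^ ((-1) ^ (n₁ + n₂))` of the functional
equation. -/
noncomputable def bipartiteEpsilon (n₁ n₂ r : ℕ) (s : ℂ) : ℂ :=
  multipleSine (s + 4 * r) (fun _ : Fin r => (4 : ℝ)) ^ ((-1 : ℤ) ^ (n₁ + n₂))

/-! ### The Grover matrix of a complete bipartite graph -/

section BipartiteDeterminant

open Matrix Kronecker

/-! Split the arcs by the side they leave. The Grover matrix is then block off-diagonal, with blocks
built from the coins `C_n = (2/n) J - I`, and a Schur complement reduces the determinant to `det (1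
- u² C_{n₁} ⊗ C_{n₂})`. Every coin is an involution, `C_2` is the swap and `C_1 = 1`, so one more
block elimination gives `(1 - u⁴)^r`.

Under `x = e^t` the integral defining `Z_f` becomes `(-1)^r` times the Mellin transform of
`e^(-(s+4r)t) / (1 - e^(-4t))^r`. Expanding the denominator geometrically and integrating termwise
yields the multiple Hurwitz series (`hasSum_multipleHurwitzTerm`), so the two zeta functions share
one continuation in `w`. That continuation exists because the kernel decays exponentially and has a
Laurent expansion at `t = 0`. The expansion contributes simple fractions with poles at `r - k`, and
the zero of `1/Γ(w)` removes the pole at `w = 0` (`exists_continuation_inv_Gamma_mul_mellin`).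

For the continuation in `x`, raising `x` by the period `c` multiplies the kernel by `e^(-ct)`,
whence `1/Γ_{r+1}(x) = 1/Γ_{r+1}(x+c) · 1/Γ_r(x)`. Starting from `1/Γ_0(x) = x`, induction on `r`
makes every `1/Γ_r` entire, with zeros only at `-ck` (`exists_entire_inv_multipleGamma`). The
functional equation is then algebra: the reflected argument on either side is `-s`. -/

/-- The arcs of `K_{n₁,n₂}`: those leaving the left side, and those leaving the right side. -/
def bipartiteDartEquiv (n₁ n₂ : ℕ) :
    (completeBipartiteGraph (Fin n₁) (Fin n₂)).Dart ≃ (Fin n₁ × Fin n₂) ⊕ (Fin n₁ × Fin n₂) where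
  toFun d := match d with
    | ⟨(Sum.inl i, Sum.inr j), _⟩ => Sum.inl (i, j)
    | ⟨(Sum.inr j, Sum.inl i), _⟩ => Sum.inr (i, j)
    | ⟨(Sum.inl _, Sum.inl _), h⟩ => absurd h (by simp)
    | ⟨(Sum.inr _, Sum.inr _), h⟩ => absurd h (by simp)
  invFun p := match p with
    | Sum.inl (i, j) => ⟨(Sum.inl i, Sum.inr j), by simp⟩
    | Sum.inr (i, j) => ⟨(Sum.inr j, Sum.inl i), by simp⟩
  left_inv d := by
    rcases d with ⟨⟨i | i, j | j⟩, h⟩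
    · exact absurd h (by simp)
    · rfl
    · rfl
    · exact absurd h (by simp)
  right_inv p := by
    rcases p with ⟨i, j⟩ | ⟨i, j⟩ <;> rfl

theorem degree_completeBipartiteGraph_inl (n₁ n₂ : ℕ) (i : Fin n₁) :
    (completeBipartiteGraph (Fin n₁) (Fin n₂)).degree (Sum.inl i) = n₂ := by
  have h : (completeBipartiteGraph (Fin n₁) (Fin n₂)).neighborFinset (Sum.inl i) =
      Finset.univ.map Function.Embedding.inr := by
    ext v
    rcases v with v | v <;> simp
  rw [← SimpleGraph.card_neighborFinset_eq_degree, h]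
  simp

theorem degree_completeBipartiteGraph_inr (n₁ n₂ : ℕ) (j : Fin n₂) :
    (completeBipartiteGraph (Fin n₁) (Fin n₂)).degree (Sum.inr j) = n₁ := by
  have h : (completeBipartiteGraph (Fin n₁) (Fin n₂)).neighborFinset (Sum.inr j) =
      Finset.univ.map Function.Embedding.inl := by
    ext v
    rcases v with v | v <;> simp
  rw [← SimpleGraph.card_neighborFinset_eq_degree, h]
  simp

/-- The local Grover matrix `(2 / n) J - I`. -/
noncomputable def groverCoin (n : ℕ) : Matrix (Fin n) (Fin n) ℂ :=
  Matrix.of fun i j => 2 / (n : ℂ) - if i = j then 1 else 0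

/-- Since `J² = n J`, the coin is the reflection in the line of constant vectors. -/
theorem groverCoin_mul_self {n : ℕ} (hn : n ≠ 0) : groverCoin n * groverCoin n = 1 := by
  have hn' : (n : ℂ) ≠ 0 := Nat.cast_ne_zero.mpr hn
  ext i j
  simp only [groverCoin, mul_apply, of_apply, sub_mul, mul_sub, Finset.sum_sub_distrib,
    Finset.sum_const, Finset.card_univ, Fintype.card_fin, nsmul_eq_mul, one_apply]
  simp
  field_simp
  ring

/-- The Grover matrix of `K_{n₁,n₂}` in block form. -/
theorem reindex_groverMatrix (n₁ n₂ : ℕ) :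
    reindex (bipartiteDartEquiv n₁ n₂) (bipartiteDartEquiv n₁ n₂)
      ((groverMatrix (completeBipartiteGraph (Fin n₁) (Fin n₂))).map (fun x : ℝ => (x : ℂ))) =
    fromBlocks 0 ((1 : Matrix (Fin n₁) (Fin n₁) ℂ) ⊗ₖ groverCoin n₂)
      (groverCoin n₁ ⊗ₖ (1 : Matrix (Fin n₂) (Fin n₂) ℂ)) 0 := by
  ext p q
  rcases p with ⟨i, j⟩ | ⟨i, j⟩ <;> rcases q with ⟨k, l⟩ | ⟨k, l⟩ <;>
    simp [bipartiteDartEquiv, groverMatrix, SimpleGraph.Dart.symm, groverCoin, one_apply,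
      SimpleGraph.Dart.ext_iff, degree_completeBipartiteGraph_inl,
      degree_completeBipartiteGraph_inr] <;>
    by_cases hik : i = k <;> by_cases hjl : j = l <;>
    simp [hik, hjl, eq_comm (a := k), eq_comm (a := l)]

/-- Schur complement with respect to the upper left identity block. -/
theorem det_one_sub_smul_fromBlocks {m n : Type*} [Fintype m] [Fintype n] [DecidableEq m]
    [DecidableEq n] (B : Matrix m n ℂ) (C : Matrix n m ℂ) (u : ℂ) :
    (1 - u • fromBlocks 0 B C 0).det = (1 - u ^ 2 • (C * B)).det := by
  have h : 1 - u • fromBlocks 0 B C 0 = fromBlocks 1 (-(u • B)) (-(u • C)) 1 := by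
    rw [fromBlocks_smul, ← fromBlocks_one, sub_eq_add_neg, fromBlocks_neg, fromBlocks_add]
    simp
  rw [h, det_fromBlocks_one₁₁]
  congr 2
  simp [smul_smul, sq]

/-- The coin of size 2 is the swap, because `2/2 - 1 = 0` on the diagonal. Hence the Kronecker
product has blocks `0, H, H, 0`, and the Schur complement involves only `H² = 1`. -/
theorem det_one_sub_smul_groverCoin_two_kronecker {ι : Type*} [Fintype ι] [DecidableEq ι]
    {H : Matrix ι ι ℂ} (hH : H * H = 1) (z : ℂ) :
    (1 - z • (groverCoin 2 ⊗ₖ H)).det = (1 - z ^ 2) ^ Fintype.card ι := by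
  let e : Fin 2 × ι ≃ ι ⊕ ι :=
    (finTwoEquiv.prodCongr (Equiv.refl ι)).trans (Equiv.boolProdEquivSum ι)
  have h : reindex e e (1 - z • (groverCoin 2 ⊗ₖ H)) = 1 - z • fromBlocks 0 H H 0 := by
    ext p q
    rcases p with i | i <;> rcases q with j | j <;>
      simp [e, groverCoin, one_apply, finTwoEquiv]
  rw [← det_reindex_self e, h, det_one_sub_smul_fromBlocks, hH]
  have : (1 : Matrix ι ι ℂ) - z ^ 2 • 1 = (1 - z ^ 2) • 1 := by rw [sub_smul, one_smul]
  rw [this, det_smul, det_one, mul_one]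

/-- The reciprocal of the zeta function of the Grover walk on `K_{n₁,n₂}`. -/
theorem bipartiteGroverZeta_eq_inv_det (n₁ n₂ : ℕ) (u : ℂ) :
    bipartiteGroverZeta n₁ n₂ u =
      (1 - u ^ 2 • (groverCoin n₁ ⊗ₖ groverCoin n₂)).det⁻¹ := by
  unfold bipartiteGroverZeta groverZeta matrixZeta
  congr 1
  rw [← det_reindex_self (bipartiteDartEquiv n₁ n₂)]
  have h := reindex_groverMatrix n₁ n₂
  have h2 : reindex (bipartiteDartEquiv n₁ n₂) (bipartiteDartEquiv n₁ n₂)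
      (1 - u • ((groverMatrix (completeBipartiteGraph (Fin n₁) (Fin n₂))).map
        (fun x : ℝ => (x : ℂ)))) = 1 - u • (fromBlocks 0
        ((1 : Matrix (Fin n₁) (Fin n₁) ℂ) ⊗ₖ groverCoin n₂)
      (groverCoin n₁ ⊗ₖ (1 : Matrix (Fin n₂) (Fin n₂) ℂ)) 0) := by
    rw [← h]
    ext p q
    simp [one_apply]
  rw [h2, det_one_sub_smul_fromBlocks, ← mul_kronecker_mul]
  simp

theorem bipartiteGroverZeta_eq {n₁ n₂ r : ℕ}
    (hn : (n₁ = 1 ∧ n₂ = 2) ∨ (n₁ = 2 ∧ 2 ≤ n₂)) (hr : r + 2 = n₁ + n₂) (u : ℂ) :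
    bipartiteGroverZeta n₁ n₂ u = ((1 - u ^ 4) ^ r)⁻¹ := by
  rw [bipartiteGroverZeta_eq_inv_det]
  congr 1
  have hu : u ^ 4 = (u ^ 2) ^ 2 := by ring
  rw [hu]
  rcases hn with ⟨rfl, rfl⟩ | ⟨rfl, h⟩
  · obtain rfl : r = 1 := by omega
    -- Here the size 2 coin is the second factor; commuting the factors moves it to the front, and
    -- the coin of size 1 plays the role of `H`.
    have h2 : reindex (Equiv.prodComm (Fin 1) (Fin 2)) (Equiv.prodComm (Fin 1) (Fin 2))
        (1 - u ^ 2 • (groverCoin 1 ⊗ₖ groverCoin 2)) =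
        1 - u ^ 2 • (groverCoin 2 ⊗ₖ groverCoin 1) := by
      ext ⟨i, j⟩ ⟨k, l⟩
      simp [one_apply, mul_comm, and_comm]
    rw [← det_reindex_self (Equiv.prodComm (Fin 1) (Fin 2)), h2,
      det_one_sub_smul_groverCoin_two_kronecker (groverCoin_mul_self one_ne_zero)]
    simp
  · obtain rfl : r = n₂ := by omega
    rw [det_one_sub_smul_groverCoin_two_kronecker (groverCoin_mul_self (by omega))]
    simp

end BipartiteDeterminant

/-! ### Normal forms and identity theorem -/

section NormalForm

open Filter Topology

/-- By uniqueness, exhibiting any one continuation in normal form evaluates the chosen one. -/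
theorem meroCont_eq {g F : ℂ → ℂ} (h : IsMeroCont g F) : meroCont g = F := by
  have h' : ∃ F, IsMeroCont g F := ⟨F, h⟩
  rw [meroCont, dif_pos h']
  exact h'.choose_spec.unique h

/-- Identity theorem: the difference has infinite order at a point of the half-plane, and infinite
order propagates over the connected plane. -/
theorem MeromorphicOn.eventuallyEq_nhdsNE_of_eqOn_halfPlane {f g : ℂ → ℂ}
    (hf : MeromorphicOn f Set.univ) (hg : MeromorphicOn g Set.univ) {c : ℝ}
    (h : ∀ z : ℂ, c < z.re → f z = g z) (x : ℂ) : f =ᶠ[𝓝[≠] x] g := by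
  have hm : MeromorphicOn (f - g) Set.univ := hf.sub hg
  have hy : meromorphicOrderAt (f - g) ((c + 1 : ℝ) : ℂ) = ⊤ := by
    rw [meromorphicOrderAt_eq_top_iff]
    have hopen : IsOpen {z : ℂ | c < z.re} := isOpen_lt continuous_const Complex.continuous_re
    have hmem : ((c + 1 : ℝ) : ℂ) ∈ {z : ℂ | c < z.re} := by simp
    filter_upwards [mem_nhdsWithin_of_mem_nhds (hopen.mem_nhds hmem)] with z hz
    simp [h z hz]
  have hx : meromorphicOrderAt (f - g) x = ⊤ := by
    by_contra hne
    exact hm.meromorphicOrderAt_ne_top_of_isPreconnected (x := x) isPreconnected_univ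
      (Set.mem_univ _) (Set.mem_univ _) hne hy
  rw [meromorphicOrderAt_eq_top_iff] at hx
  filter_upwards [hx] with z hz
  exact sub_eq_zero.mp hz

theorem AnalyticAt.eventuallyEq_nhds_of_nhdsNE {f g : ℂ → ℂ} {x : ℂ} (hf : AnalyticAt ℂ f x)
    (hg : AnalyticAt ℂ g x) (h : f =ᶠ[𝓝[≠] x] g) : f =ᶠ[𝓝 x] g :=
  (hf.meromorphicNFAt.eventuallyEq_nhdsNE_iff_eventuallyEq_nhds hg.meromorphicNFAt).mp h

/-- Passing to normal form can change values on a discrete set; this recovers the true values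
wherever an analytic representative is known. -/
theorem MeromorphicOn.toMeromorphicNFOn_eventuallyEq_nhds {f g : ℂ → ℂ}
    (hf : MeromorphicOn f Set.univ) {x : ℂ} (hg : AnalyticAt ℂ g x) (h : f =ᶠ[𝓝[≠] x] g) :
    toMeromorphicNFOn f Set.univ =ᶠ[𝓝 x] g :=
  ((meromorphicNFOn_toMeromorphicNFOn f Set.univ
    (Set.mem_univ x)).eventuallyEq_nhdsNE_iff_eventuallyEq_nhds hg.meromorphicNFAt).mp
    ((hf.toMeromorphicNFOn_eq_self_on_nhdsNE (Set.mem_univ x)).trans h)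

end NormalForm

/-! ### Series of simple fractions -/

section SimpleFractions

open Filter Topology

/-- Separation from `p` is demanded only for a nonzero coefficient, so that a pole can be excised
from a series by zeroing its coefficient. -/
theorem norm_div_sub_le {s p w : ℂ} (h : s ≠ 0 → 1 / 2 ≤ ‖w - p‖) : ‖s / (w - p)‖ ≤ 2 * ‖s‖ := by
  rcases eq_or_ne s 0 with rfl | hs
  · simp
  · rw [norm_div, div_le_iff₀ (by linarith [h hs])]
    nlinarith [h hs, norm_nonneg s]

theorem summable_div_sub {s p : ℕ → ℂ} (hs : Summable fun k => ‖s k‖) {w : ℂ}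
    (hp : ∀ k, s k ≠ 0 → 1 / 2 ≤ ‖w - p k‖) : Summable fun k => s k / (w - p k) :=
  Summable.of_norm_bounded (hs.mul_left 2) fun k => norm_div_sub_le (hp k)

theorem differentiableOn_tsum_div_sub {s p : ℕ → ℂ} (hs : Summable fun k => ‖s k‖) {U : Set ℂ}
    (hU : IsOpen U) (hp : ∀ w ∈ U, ∀ k, s k ≠ 0 → 1 / 2 ≤ ‖w - p k‖) :
    DifferentiableOn ℂ (fun w => ∑' k, s k / (w - p k)) U := by
  refine Complex.differentiableOn_tsum_of_summable_norm (hs.mul_left 2) (fun k => ?_) hU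
    fun k w hw => norm_div_sub_le (hp w hw k)
  rcases eq_or_ne (s k) 0 with h | h
  · simp [h]
  · intro w hw
    have : w - p k ≠ 0 := by
      intro h0
      have := hp w hw k h
      rw [h0, norm_zero] at this
      linarith
    fun_prop (disch := assumption)

theorem half_le_norm_sub_natCast_sub {r N k : ℕ} {w : ℂ} (hw : ‖w‖ < (N : ℝ) - r - 1 / 2)
    (hk : N ≤ k) : 1 / 2 ≤ ‖w - ((r : ℂ) - k)‖ := by
  have h1 : ‖((k : ℂ) - r)‖ ≤ ‖w - ((r : ℂ) - k)‖ + ‖w‖ := by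
    have h0 : (k : ℂ) - r = w - ((r : ℂ) - k) - w := by ring
    rw [h0]
    exact norm_sub_le _ _
  have h2 : (k : ℝ) - r ≤ ‖((k : ℂ) - r)‖ := by
    have := Complex.re_le_norm ((k : ℂ) - r)
    simpa using this
  have h3 : (N : ℝ) ≤ k := by exact_mod_cast hk
  linarith

/-- A series of simple fractions with poles at `r, r - 1, r - 2, …` is meromorphic. -/
theorem meromorphicOn_tsum_div_sub {s : ℕ → ℂ} (hs : Summable fun k => ‖s k‖) (r : ℕ) :
    MeromorphicOn (fun w : ℂ => ∑' k, s k / (w - ((r : ℂ) - k))) Set.univ := by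
  intro w₀ _
  -- From index `N` on, the poles stay at distance at least `1/2` from a neighbourhood of `w₀`: the
  -- tail is holomorphic there and the head is a finite sum.
  obtain ⟨N, hN⟩ := exists_nat_gt (‖w₀‖ + r + 1)
  have hU : IsOpen {w : ℂ | ‖w‖ < (N : ℝ) - r - 1 / 2} := isOpen_lt continuous_norm continuous_const
  have hw₀ : w₀ ∈ {w : ℂ | ‖w‖ < (N : ℝ) - r - 1 / 2} := by
    simp only [Set.mem_ofPred_eq]; linarith
  have hs' : Summable fun k => ‖s (k + N)‖ := (summable_nat_add_iff N).mpr hs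
  have hp : ∀ w ∈ {w : ℂ | ‖w‖ < (N : ℝ) - r - 1 / 2}, ∀ k, s (k + N) ≠ 0 →
      1 / 2 ≤ ‖w - ((r : ℂ) - (k + N : ℕ))‖ :=
    fun w hw k _ => half_le_norm_sub_natCast_sub hw (Nat.le_add_left N k)
  have hd := differentiableOn_tsum_div_sub hs' hU hp
  have hterm : ∀ k : ℕ, MeromorphicAt (fun w : ℂ => s k / (w - ((r : ℂ) - k))) w₀ := fun k =>
    (MeromorphicAt.const (s k) w₀).fun_div
      ((MeromorphicAt.id w₀).fun_sub (MeromorphicAt.const ((r : ℂ) - k) w₀))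
  have hm : MeromorphicAt (fun w : ℂ => ∑ k ∈ Finset.range N, s k / (w - ((r : ℂ) - k)) +
      ∑' k, s (k + N) / (w - ((r : ℂ) - (k + N : ℕ)))) w₀ :=
    MeromorphicAt.fun_add (MeromorphicAt.fun_sum fun k _ => hterm k)
      (hd.analyticAt (hU.mem_nhds hw₀)).meromorphicAt
  refine hm.congr (mem_nhdsWithin_of_mem_nhds ?_)
  filter_upwards [hU.mem_nhds hw₀] with w hw
  have hsum : Summable fun k => s (k + N) / (w - ((r : ℂ) - (k + N : ℕ))) :=
    summable_div_sub hs' (hp w hw)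
  exact Summable.sum_add_tsum_nat_add' (f := fun k => s k / (w - ((r : ℂ) - k))) hsum

end SimpleFractions

/-! ### Differentiating Laplace transforms -/

section Laplace

open MeasureTheory Set Filter Topology

/-- A Laplace transform is holomorphic to the right of its abscissa of absolute convergence. -/
theorem differentiableAt_laplace {S : Set ℝ} (hS : MeasurableSet S) (hpos : S ⊆ Ioi 0) {f : ℝ → ℂ}
    {σ : ℝ} (hf : IntegrableOn (fun t : ℝ => Complex.exp (-((σ : ℂ) * t)) * f t) S) {x₀ : ℂ}
    (hx : σ < x₀.re) :
    DifferentiableAt ℂ (fun x : ℂ => ∫ t in S, Complex.exp (-(x * t)) * f t) x₀ := by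
  -- Half of the available margin keeps `x` in the half-plane; the remaining decay absorbs the
  -- factor `t` from differentiation, by `t e^(-εt) ≤ 1/ε`.
  set ε := (x₀.re - σ) / 2 with hε
  have hε0 : 0 < ε := by rw [hε]; linarith
  have hmeas : ∀ x : ℂ, AEStronglyMeasurable (fun t : ℝ => Complex.exp (-(x * t)) * f t)
      (volume.restrict S) := by
    intro x
    have h1 : AEStronglyMeasurable (fun t : ℝ => Complex.exp (-((x - σ) * t)) *
        (Complex.exp (-((σ : ℂ) * t)) * f t)) (volume.restrict S) := by
      refine AEStronglyMeasurable.mul ?_ hf.1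
      exact (by fun_prop :
        Continuous fun t : ℝ => Complex.exp (-((x - σ) * t))).aestronglyMeasurable
    refine h1.congr (Eventually.of_forall fun t => ?_)
    simp only
    rw [← mul_assoc, ← Complex.exp_add]
    ring_nf
  have hnorm : ∀ (x : ℂ) (t : ℝ), ‖Complex.exp (-(x * t)) * f t‖ =
      Real.exp (-((x.re - σ) * t)) * ‖Complex.exp (-((σ : ℂ) * t)) * f t‖ := by
    intro x t
    rw [norm_mul, norm_mul, Complex.norm_exp, Complex.norm_exp, ← mul_assoc, ← Real.exp_add]
    simp
    left
    ring
  have hint : ∀ x : ℂ, σ ≤ x.re → IntegrableOn (fun t : ℝ => Complex.exp (-(x * t)) * f t) S := by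
    intro x hσ
    refine Integrable.mono hf (hmeas x) ?_
    filter_upwards [ae_restrict_mem hS] with t ht
    rw [hnorm]
    have : Real.exp (-((x.re - σ) * t)) ≤ 1 := by
      rw [Real.exp_le_one_iff]
      have : 0 < t := hpos ht
      nlinarith
    exact mul_le_of_le_one_left (norm_nonneg _) this
  have hball : Metric.ball x₀ ε ∈ 𝓝 x₀ := Metric.ball_mem_nhds _ hε0
  refine (hasDerivAt_integral_of_dominated_loc_of_deriv_le (μ := volume.restrict S)
    (F := fun (x : ℂ) (t : ℝ) => Complex.exp (-(x * t)) * f t)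
    (F' := fun (x : ℂ) (t : ℝ) => -(t : ℂ) * (Complex.exp (-(x * t)) * f t))
    (bound := fun t : ℝ => ε⁻¹ * ‖Complex.exp (-((σ : ℂ) * t)) * f t‖) hball
    (Eventually.of_forall hmeas) (hint x₀ hx.le) ?_ ?_ (hf.norm.const_mul _) ?_).2.differentiableAt
  · refine AEStronglyMeasurable.mul ?_ (hmeas x₀)
    exact (by fun_prop : Continuous fun t : ℝ => -(t : ℂ)).aestronglyMeasurable
  · filter_upwards [ae_restrict_mem hS] with t ht x hxb
    have ht0 : 0 < t := hpos ht
    have hre : σ + ε ≤ x.re := by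
      have h1 : |(x - x₀).re| ≤ ‖x - x₀‖ := Complex.abs_re_le_norm _
      have h2 : ‖x - x₀‖ < ε := by rwa [← dist_eq_norm]
      have h3 := (abs_le.mp (h1.trans h2.le)).1
      rw [Complex.sub_re] at h3
      linarith
    rw [norm_mul, hnorm, ← mul_assoc]
    refine mul_le_mul_of_nonneg_right ?_ (norm_nonneg _)
    rw [norm_neg, Complex.norm_real, Real.norm_of_nonneg ht0.le]
    have h1 : Real.exp (-((x.re - σ) * t)) ≤ Real.exp (-(ε * t)) := by
      rw [Real.exp_le_exp]
      nlinarith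
    have h2 : ε * t * Real.exp (-(ε * t)) ≤ 1 := by
      rw [Real.exp_neg, ← div_eq_mul_inv, div_le_one (Real.exp_pos _)]
      linarith [Real.add_one_le_exp (ε * t)]
    calc t * Real.exp (-((x.re - σ) * t)) ≤ t * Real.exp (-(ε * t)) :=
          mul_le_mul_of_nonneg_left h1 ht0.le
      _ = ε⁻¹ * (ε * t * Real.exp (-(ε * t))) := by field_simp
      _ ≤ ε⁻¹ * 1 := mul_le_mul_of_nonneg_left h2 (inv_pos.mpr hε0).le
      _ = ε⁻¹ := mul_one _
  · refine Eventually.of_forall fun t x _ => ?_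
    have h1 : HasDerivAt (fun x : ℂ => -(x * t)) (-(t : ℂ)) x := by
      simpa using! ((hasDerivAt_id x).mul_const (t : ℂ)).neg
    have h2 := (h1.cexp).mul_const (f t)
    rw [mul_comm (Complex.exp _), mul_assoc] at h2
    exact h2

/-- The Gamma integral `∫ t ^ (w - 1) e ^ (-x t) dt` for complex `x` in the right half-plane. -/
theorem integral_exp_mul_cpow_Ioi {w x : ℂ} (hw : 0 < w.re) (hx : 0 < x.re) :
    ∫ t in Ioi (0 : ℝ), Complex.exp (-(x * t)) * (t : ℂ) ^ (w - 1) =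
      Complex.Gamma w * x ^ (-w) := by
  have hreal : ∀ ρ : ℝ, 0 < ρ → ∫ t in Ioi (0 : ℝ), Complex.exp (-((ρ : ℂ) * t)) *
      (t : ℂ) ^ (w - 1) = Complex.Gamma w * (ρ : ℂ) ^ (-w) := by
    intro ρ hρ
    rw [mul_comm (Complex.Gamma w), Complex.cpow_neg, ← Complex.inv_cpow, ← one_div,
      ← Complex.integral_cpow_mul_exp_neg_mul_Ioi hw hρ]
    · simp only [mul_comm]
    · rw [Complex.arg_ofReal_of_nonneg hρ.le]
      exact Real.pi_pos.ne
  have hint : ∀ ρ : ℝ, 0 < ρ → IntegrableOn (fun t : ℝ => Complex.exp (-((ρ : ℂ) * t)) *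
      (t : ℂ) ^ (w - 1)) (Ioi 0) := by
    intro ρ hρ
    have h : MellinConvergent (fun t : ℝ => Complex.exp (-((ρ : ℂ) * t))) w := by
      have hc : Continuous fun t : ℝ => Complex.exp (-((ρ : ℂ) * t)) := by fun_prop
      refine mellinConvergent_of_isBigO_rpow_exp hρ (b := 0)
        (hc.locallyIntegrable.locallyIntegrableOn _) ?_ ?_ hw
      · refine Asymptotics.IsBigO.of_bound 1 (Eventually.of_forall fun t => ?_)
        rw [Complex.norm_exp]
        simp
      · simp only [neg_zero, Real.rpow_zero]
        exact (hc.tendsto 0).isBigO_one ℝ |>.mono nhdsWithin_le_nhds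
    refine h.congr_fun (fun t _ => ?_) measurableSet_Ioi
    simp [mul_comm]
  have hopen : IsOpen {z : ℂ | 0 < z.re} := isOpen_lt continuous_const Complex.continuous_re
  have h1 : AnalyticOnNhd ℂ (fun x : ℂ => ∫ t in Ioi (0 : ℝ), Complex.exp (-(x * t)) *
      (t : ℂ) ^ (w - 1)) {z : ℂ | 0 < z.re} := by
    refine DifferentiableOn.analyticOnNhd (fun z hz => ?_) hopen
    have hz' : 0 < z.re := hz
    exact (differentiableAt_laplace measurableSet_Ioi subset_rfl (σ := z.re / 2)
      (hint (z.re / 2) (by linarith)) (by linarith)).differentiableWithinAt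
  have h2 : AnalyticOnNhd ℂ (fun x : ℂ => Complex.Gamma w * x ^ (-w)) {z : ℂ | 0 < z.re} := by
    refine DifferentiableOn.analyticOnNhd (fun z hz => ?_) hopen
    have hz' : z ∈ Complex.slitPlane := Or.inl hz
    exact ((differentiableAt_id.cpow_const hz').const_mul _).differentiableWithinAt
  have hconn : IsPreconnected {z : ℂ | 0 < z.re} := (convex_halfSpace_re_gt 0).isPreconnected
  have h1mem : (1 : ℂ) ∈ {z : ℂ | 0 < z.re} := by simp
  refine h1.eqOn_of_preconnected_of_frequently_eq h2 hconn h1mem ?_ hx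
  -- Real points accumulating at `1` carry the formula from positive reals to the half-plane.
  have htend : Tendsto (fun n : ℕ => (((1 : ℝ) + 1 / ((n : ℝ) + 1) : ℝ) : ℂ)) atTop (𝓝[≠] 1) := by
    refine tendsto_nhdsWithin_iff.mpr ⟨?_, Eventually.of_forall fun n => ?_⟩
    · have h3 : Tendsto (fun n : ℕ => (1 : ℝ) + 1 / ((n : ℝ) + 1)) atTop (𝓝 (1 + 0)) :=
        tendsto_const_nhds.add tendsto_one_div_add_atTop_nhds_zero_nat
      have := (Complex.continuous_ofReal.tendsto _).comp h3
      simpa [Function.comp_def] using this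
    · have h4 : (0 : ℝ) < 1 / ((n : ℝ) + 1) := by positivity
      simp only [Set.mem_compl_iff, Set.mem_singleton_iff]
      intro h
      have h5 : (1 : ℝ) + 1 / ((n : ℝ) + 1) = 1 := by exact_mod_cast h
      linarith
  exact htend.frequently (Frequently.of_forall fun n => hreal _ (by positivity))

end Laplace

/-! ### The kernel of the multiple Hurwitz zeta function and its Mellin transform -/

section Kernel

open MeasureTheory Set Filter Topology

/-- The kernel `e ^ (-x t) / (1 - e ^ (-c t)) ^ r`. -/
noncomputable def multipleKernel (r : ℕ) (c : ℝ) (x : ℂ) (t : ℝ) : ℂ :=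
  Complex.exp (-(x * t)) * (((1 - Real.exp (-(c * t))) ^ r : ℝ) : ℂ)⁻¹

theorem one_sub_exp_neg_mul_pos {c t : ℝ} (hc : 0 < c) (ht : 0 < t) :
    0 < 1 - Real.exp (-(c * t)) := by
  have : Real.exp (-(c * t)) < 1 := Real.exp_lt_one_iff.mpr (by nlinarith)
  linarith

theorem norm_multipleKernel {r : ℕ} {c t : ℝ} (hc : 0 < c) (ht : 0 < t) (x : ℂ) :
    ‖multipleKernel r c x t‖ =
      Real.exp (-(x.re * t)) * ((1 - Real.exp (-(c * t))) ^ r)⁻¹ := by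
  rw [multipleKernel, norm_mul, norm_inv, Complex.norm_real, Complex.norm_exp,
    Real.norm_of_nonneg (pow_nonneg (one_sub_exp_neg_mul_pos hc ht).le r)]
  simp

theorem continuousOn_multipleKernel {c : ℝ} (hc : 0 < c) (r : ℕ) (x : ℂ) :
    ContinuousOn (multipleKernel r c x) (Ioi 0) := by
  unfold multipleKernel
  refine ContinuousOn.mul (by fun_prop) (ContinuousOn.inv₀ (by fun_prop) fun t ht => ?_)
  exact Complex.ofReal_ne_zero.mpr (pow_pos (one_sub_exp_neg_mul_pos hc ht) r).ne'

theorem norm_multipleKernel_le {c δ t : ℝ} (hc : 0 < c) (hδ : 0 < δ) (ht : δ ≤ t) (r : ℕ) (x : ℂ) :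
    ‖multipleKernel r c x t‖ ≤
      ((1 - Real.exp (-(c * δ))) ^ r)⁻¹ * Real.exp (-x.re * t) := by
  rw [norm_multipleKernel hc (hδ.trans_le ht), mul_comm, neg_mul]
  have h1 := one_sub_exp_neg_mul_pos hc hδ
  have h2 : Real.exp (-(c * t)) ≤ Real.exp (-(c * δ)) := by
    rw [Real.exp_le_exp]; nlinarith
  gcongr

theorem multipleKernel_isBigO_atTop {c : ℝ} (hc : 0 < c) (r : ℕ) (x : ℂ) :
    multipleKernel r c x =O[atTop] fun t => Real.exp (-x.re * t) := by
  refine Asymptotics.IsBigO.of_bound (((1 - Real.exp (-(c * 1))) ^ r)⁻¹) ?_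
  filter_upwards [eventually_ge_atTop 1] with t ht
  rw [Real.norm_of_nonneg (Real.exp_pos _).le]
  exact norm_multipleKernel_le hc one_pos ht r x

/-- The shift by `c` multiplies the kernel by `e^(-ct)`, so the difference cancels one factor of the
denominator. This is the source of the recursion in `r`. -/
theorem multipleKernel_succ_sub {c t : ℝ} (hc : 0 < c) (ht : 0 < t) (r : ℕ) (x : ℂ) :
    multipleKernel (r + 1) c x t - multipleKernel (r + 1) c (x + c) t = multipleKernel r c x t := by
  have h := (one_sub_exp_neg_mul_pos hc ht).ne'
  have h' : ((1 - Real.exp (-(c * t)) : ℝ) : ℂ) ≠ 0 := Complex.ofReal_ne_zero.mpr h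
  have he : Complex.exp (-((x + c) * t)) =
      Complex.exp (-(x * t)) * (Real.exp (-(c * t)) : ℝ) := by
    rw [Complex.ofReal_exp, ← Complex.exp_add]
    push_cast
    ring_nf
  unfold multipleKernel
  rw [he]
  push_cast at h' ⊢
  rw [pow_succ, mul_inv]
  set a := 1 - Complex.exp (-(c * t)) with ha
  have ha' : Complex.exp (-(c * t)) = 1 - a := by rw [ha]; ring
  rw [ha']
  linear_combination Complex.exp (-(x * t)) * (a ^ r)⁻¹ * mul_inv_cancel₀ h'

/-- The Taylor expansion at `0` of `(t / (1 - e ^ (-c t))) ^ r`. -/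
theorem exists_hasSum_kernel {c : ℝ} (hc : 0 < c) (r : ℕ) :
    ∃ δ : ℝ, 0 < δ ∧ ∃ b : ℕ → ℂ, (Summable fun k => ‖b k‖ * δ ^ k) ∧
      ∀ t ∈ Ioc 0 δ, HasSum (fun k => b k * (t : ℂ) ^ k)
        ((t : ℂ) ^ r * (((1 - Real.exp (-(c * t))) ^ r : ℝ) : ℂ)⁻¹) := by
  have hd : Differentiable ℂ (fun z : ℂ => 1 - Complex.exp (-(c * z))) := by fun_prop
  -- Dividing out the simple zero at `0` leaves the entire function `(1 - e^(-cz)) / z`, with value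
  -- `c` at `0`.
  set q : ℂ → ℂ := dslope (fun z : ℂ => 1 - Complex.exp (-(c * z))) 0 with hq
  have hqd : Differentiable ℂ q := by
    have := (Complex.differentiableOn_dslope (s := univ) (c := (0 : ℂ)) univ_mem).mpr
      hd.differentiableOn
    exact differentiableOn_univ.mp this
  have hqval : ∀ z : ℂ, z ≠ 0 → q z = (1 - Complex.exp (-(c * z))) / z := by
    intro z hz
    rw [hq, dslope_of_ne _ hz, slope_def_field]
    simp
  have hq0 : q 0 = c := by
    rw [hq, dslope_same]
    have h1 : HasDerivAt (fun z : ℂ => -((c : ℂ) * z)) (-(c : ℂ)) 0 := by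
      simpa using! ((hasDerivAt_id (0 : ℂ)).const_mul (c : ℂ)).neg
    have h2 := (h1.cexp).const_sub 1
    rw [h2.deriv]
    simp
  -- If `e^y = 1` with `y = -cz`, then `‖e^y - 1 - y‖ ≤ ‖y‖²` reads `‖y‖ ≤ ‖y‖²`, impossible for `0
  -- < ‖y‖ < 1`.
  have hne : ∀ z ∈ Metric.ball (0 : ℂ) c⁻¹, q z ≠ 0 := by
    intro z hz h0
    rcases eq_or_ne z 0 with rfl | hz0
    · rw [hq0] at h0
      exact hc.ne' (Complex.ofReal_eq_zero.mp h0)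
    · rw [hqval z hz0, div_eq_zero_iff, or_iff_left hz0] at h0
      have hnorm : ‖-((c : ℂ) * z)‖ = c * ‖z‖ := by
        rw [norm_neg, norm_mul, Complex.norm_real, Real.norm_of_nonneg hc.le]
      have hlt : c * ‖z‖ < 1 := by
        rw [mem_ball_zero_iff] at hz
        calc c * ‖z‖ < c * c⁻¹ := by gcongr
          _ = 1 := mul_inv_cancel₀ hc.ne'
      have hpos : 0 < c * ‖z‖ := mul_pos hc (norm_pos_iff.mpr hz0)
      have h1 := Complex.norm_exp_sub_one_sub_id_le (x := -((c : ℂ) * z))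
        (by rw [hnorm]; exact hlt.le)
      have h2 : Complex.exp (-(c * z)) - 1 - -(c * z) = -(-((c : ℂ) * z)) := by
        linear_combination -h0
      rw [h2, norm_neg, hnorm] at h1
      nlinarith
  have hg : DifferentiableOn ℂ (fun z => (q z ^ r)⁻¹) (Metric.ball 0 c⁻¹) := fun z hz =>
    ((hqd z).pow r |>.inv (pow_ne_zero r (hne z hz))).differentiableWithinAt
  have hsum : ∀ z ∈ Metric.ball (0 : ℂ) c⁻¹, HasSum (fun n : ℕ => ((n.factorial : ℂ)⁻¹ *
      iteratedDeriv n (fun z => (q z ^ r)⁻¹) 0) * z ^ n) ((q z ^ r)⁻¹) := by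
    intro z hz
    have := Complex.hasSum_taylorSeries_on_ball hg hz
    refine this.congr_fun fun n => ?_
    simp only [sub_zero, smul_eq_mul]
    ring
  have hδ : 0 < c⁻¹ / 2 := by positivity
  have hmem : ∀ t : ℝ, t ∈ Ioc 0 (c⁻¹ / 2) → (t : ℂ) ∈ Metric.ball (0 : ℂ) c⁻¹ := by
    intro t ht
    rw [mem_ball_zero_iff, Complex.norm_real, Real.norm_of_nonneg ht.1.le]
    linarith [ht.2]
  refine ⟨c⁻¹ / 2, hδ, fun n => (n.factorial : ℂ)⁻¹ * iteratedDeriv n (fun z => (q z ^ r)⁻¹) 0,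
    ?_, fun t ht => ?_⟩
  · have h := (hsum _ (hmem _ ⟨hδ, le_rfl⟩)).summable.norm
    refine h.congr fun k => ?_
    rw [norm_mul, norm_pow, Complex.norm_real, Real.norm_of_nonneg hδ.le]
  · have h := hsum t (hmem t ht)
    convert h using 1
    have ht0 : (t : ℂ) ≠ 0 := Complex.ofReal_ne_zero.mpr ht.1.ne'
    rw [hqval _ ht0, div_pow, inv_div]
    push_cast
    rw [div_eq_mul_inv]

/-- The coefficients of the product of a power series with `e ^ (-x t)`. -/
noncomputable def expMulCoeff (b : ℕ → ℂ) (x : ℂ) (k : ℕ) : ℂ :=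
  ∑ p ∈ Finset.HasAntidiagonal.antidiagonal k, b p.1 * ((-x) ^ p.2 / (p.2.factorial : ℂ))

theorem summable_exp_term (y : ℝ) : Summable fun j : ℕ => ‖y ^ j / (j.factorial : ℝ)‖ :=
  (Real.summable_pow_div_factorial y).norm

/-- One majorant serves all `‖x‖ ≤ X`: it is the Cauchy product of `∑ ‖b k‖ δ^k` with the series of
`e^(Xδ)`. This uniformity later gives holomorphy in `x`. -/
theorem exists_bound_expMulCoeff {b : ℕ → ℂ} {δ : ℝ} (hδ : 0 < δ)
    (hb : Summable fun k => ‖b k‖ * δ ^ k) (X : ℝ) :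
    ∃ A : ℕ → ℝ, Summable A ∧ ∀ x : ℂ, ‖x‖ ≤ X → ∀ k, ‖expMulCoeff b x k‖ * δ ^ k ≤ A k := by
  have h1 : Summable fun k => ‖‖b k‖ * δ ^ k‖ := hb.norm
  have h := summable_norm_sum_mul_antidiagonal_of_summable_norm h1 (summable_exp_term (X * δ))
  refine ⟨_, h.of_norm, fun x hx k => ?_⟩
  unfold expMulCoeff
  rw [← le_div_iff₀ (by positivity), Finset.sum_div]
  refine (norm_sum_le _ _).trans (Finset.sum_le_sum fun p hp => ?_)
  rw [Finset.HasAntidiagonal.mem_antidiagonal] at hp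
  rw [norm_mul, norm_div, norm_pow, norm_neg, le_div_iff₀ (by positivity), ← hp, pow_add,
    Complex.norm_natCast]
  have : ‖x‖ ^ p.2 ≤ X ^ p.2 := by gcongr
  calc ‖b p.1‖ * (‖x‖ ^ p.2 / (p.2.factorial : ℝ)) * (δ ^ p.1 * δ ^ p.2)
      ≤ ‖b p.1‖ * (X ^ p.2 / (p.2.factorial : ℝ)) * (δ ^ p.1 * δ ^ p.2) := by gcongr
    _ = ‖b p.1‖ * δ ^ p.1 * ((X * δ) ^ p.2 / (p.2.factorial : ℝ)) := by
      rw [mul_pow]; ring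

theorem hasSum_expMulCoeff {b : ℕ → ℂ} {δ t : ℝ} (hb : Summable fun k => ‖b k‖ * δ ^ k)
    (ht : t ∈ Ioc 0 δ) {y : ℂ} (hy : HasSum (fun k => b k * (t : ℂ) ^ k) y) (x : ℂ) :
    HasSum (fun k => expMulCoeff b x k * (t : ℂ) ^ k) (Complex.exp (-(x * t)) * y) := by
  have h1 : Summable fun k => ‖b k * (t : ℂ) ^ k‖ := by
    refine Summable.of_nonneg_of_le (fun _ => norm_nonneg _) (fun k => ?_) hb
    rw [norm_mul, norm_pow, Complex.norm_real, Real.norm_of_nonneg ht.1.le]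
    have := ht.1.le
    have := ht.2
    gcongr
  have h2 : Summable fun j : ℕ => ‖(-(x * t)) ^ j / (j.factorial : ℂ)‖ := by
    refine (summable_exp_term ‖x * t‖).congr fun j => ?_
    simp
  have h3 := tsum_mul_tsum_eq_tsum_sum_antidiagonal_of_summable_norm h1 h2
  have h4 := summable_norm_sum_mul_antidiagonal_of_summable_norm h1 h2
  have h5 : ∑' j : ℕ, (-(x * t)) ^ j / (j.factorial : ℂ) = Complex.exp (-(x * t)) := by
    rw [Complex.exp_eq_exp_ℂ, NormedSpace.exp_eq_tsum_div]
  rw [hy.tsum_eq, h5, mul_comm] at h3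
  rw [h3]
  refine h4.of_norm.hasSum.congr_fun fun k => ?_
  unfold expMulCoeff
  rw [Finset.sum_mul]
  refine Finset.sum_congr rfl fun p hp => ?_
  rw [Finset.HasAntidiagonal.mem_antidiagonal] at hp
  rw [← hp, ← neg_mul, mul_pow, pow_add]
  ring

theorem differentiable_expMulCoeff (b : ℕ → ℂ) (k : ℕ) :
    Differentiable ℂ fun x => expMulCoeff b x k := by
  unfold expMulCoeff
  fun_prop

end Kernel

/-! ### Continuation of Mellin transforms of functions with a Laurent expansion at `0` -/

section MellinContinuation

open MeasureTheory Set Filter Topology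

variable {K : ℝ → ℂ} {a : ℕ → ℂ} {δ : ℝ} {r : ℕ}

theorem isBigO_nhdsGT_zero_of_hasSum (hδ : 0 < δ) (ha : Summable fun k => ‖a k‖ * δ ^ k)
    (h : ∀ t ∈ Ioc 0 δ, HasSum (fun k => a k * (t : ℂ) ^ k) ((t : ℂ) ^ r * K t)) :
    K =O[𝓝[>] 0] fun t : ℝ => t ^ (-(r : ℝ)) := by
  refine Asymptotics.IsBigO.of_bound (∑' k, ‖a k‖ * δ ^ k) ?_
  filter_upwards [Ioc_mem_nhdsGT hδ] with t ht
  have ht0 : 0 < t := ht.1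
  have h1 : ‖(t : ℂ) ^ r * K t‖ ≤ ∑' k, ‖a k‖ * δ ^ k := by
    rw [← (h t ht).tsum_eq]
    refine tsum_of_norm_bounded ha.hasSum fun k => ?_
    rw [norm_mul, norm_pow, Complex.norm_real, Real.norm_of_nonneg ht0.le]
    have := ht.2
    gcongr
  rw [norm_mul, norm_pow, Complex.norm_real, Real.norm_of_nonneg ht0.le] at h1
  rw [Real.norm_of_nonneg (by positivity), Real.rpow_neg ht0.le, Real.rpow_natCast,
    ← div_eq_mul_inv, le_div_iff₀ (by positivity), mul_comm]
  exact h1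

/-- Termwise integration: each `t^(w-1-r+k)` integrates to `δ^(w-r+k) / (w-r+k)`, and the right side
makes sense beyond the half-plane. -/
theorem setIntegral_Ioc_cpow_smul_of_hasSum (hδ : 0 < δ) (ha : Summable fun k => ‖a k‖ * δ ^ k)
    (h : ∀ t ∈ Ioc 0 δ, HasSum (fun k => a k * (t : ℂ) ^ k) ((t : ℂ) ^ r * K t)) {w : ℂ}
    (hw : (r : ℝ) < w.re) :
    ∫ t in Ioc 0 δ, (t : ℂ) ^ (w - 1) • K t =
      (δ : ℂ) ^ (w - r) * ∑' k, a k * (δ : ℂ) ^ k / (w - ((r : ℂ) - k)) := by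
  have hre : ∀ k : ℕ, -1 < (w - 1 - r + k).re := by
    intro k
    have : (0 : ℝ) ≤ k := Nat.cast_nonneg k
    simp
    linarith
  have hδ0 : (δ : ℂ) ≠ 0 := Complex.ofReal_ne_zero.mpr hδ.ne'
  have hint : ∀ k : ℕ, IntegrableOn (fun t : ℝ => a k * (t : ℂ) ^ (w - 1 - r + k)) (Ioc 0 δ) := by
    intro k
    have := (intervalIntegral.intervalIntegrable_cpow' (a := 0) (b := δ) (hre k)).const_mul (a k)
    rwa [intervalIntegrable_iff_integrableOn_Ioc_of_le hδ.le] at this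
  have hsum : Summable fun k : ℕ => ∫ t in Ioc 0 δ, ‖a k * (t : ℂ) ^ (w - 1 - r + k)‖ := by
    refine Summable.of_nonneg_of_le (fun k => integral_nonneg fun t => norm_nonneg _) (fun k => ?_)
      (ha.mul_right (δ ^ (w.re - r) / (w.re - r)))
    have h1 : ∫ t in Ioc 0 δ, ‖a k * (t : ℂ) ^ (w - 1 - r + k)‖ =
        ∫ t in Ioc 0 δ, ‖a k‖ * t ^ (w.re - 1 - r + k) := by
      refine setIntegral_congr_fun measurableSet_Ioc fun t ht => ?_
      rw [norm_mul, Complex.norm_cpow_eq_rpow_re_of_pos ht.1]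
      simp
    have hre' : -1 < w.re - 1 - r + k := by simpa using hre k
    rw [h1, ← intervalIntegral.integral_of_le hδ.le, intervalIntegral.integral_const_mul,
      integral_rpow (Or.inl hre'), Real.zero_rpow (by linarith), sub_zero, mul_assoc]
    refine mul_le_mul_of_nonneg_left ?_ (norm_nonneg _)
    have h2 : w.re - 1 - r + k + 1 = (w.re - r) + k := by ring
    rw [h2, Real.rpow_add hδ, Real.rpow_natCast, mul_comm, mul_div_assoc]
    have h3 : (0 : ℝ) ≤ k := Nat.cast_nonneg k
    have h4 : 0 < w.re - r := by linarith
    gcongr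
    linarith
  have hmain := hasSum_integral_of_summable_integral_norm hint hsum
  have hlhs : ∫ t in Ioc 0 δ, (∑' k, a k * (t : ℂ) ^ (w - 1 - r + k)) =
      ∫ t in Ioc 0 δ, (t : ℂ) ^ (w - 1) • K t := by
    refine setIntegral_congr_fun measurableSet_Ioc fun t ht => ?_
    have ht0 : (t : ℂ) ≠ 0 := Complex.ofReal_ne_zero.mpr ht.1.ne'
    have h1 := (h t ht).mul_left ((t : ℂ) ^ (w - 1 - r))
    have h2 : (t : ℂ) ^ (w - 1 - r) * ((t : ℂ) ^ r * K t) = (t : ℂ) ^ (w - 1) • K t := by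
      rw [← mul_assoc, ← Complex.cpow_natCast, ← Complex.cpow_add _ _ ht0, sub_add_cancel,
        smul_eq_mul]
    rw [← h2, ← h1.tsum_eq]
    refine tsum_congr fun k => ?_
    rw [Complex.cpow_add _ _ ht0, Complex.cpow_natCast]
    ring
  rw [← hlhs, ← hmain.tsum_eq, ← tsum_mul_left]
  refine tsum_congr fun k => ?_
  have h5 : w - 1 - r + k + 1 = w - r + k := by ring
  have h6 : w - r + k ≠ 0 := by
    intro h0
    have := hre k
    have h7 := congrArg Complex.re h0
    simp at this h7
    linarith
  rw [← intervalIntegral.integral_of_le hδ.le, intervalIntegral.integral_const_mul,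
    integral_cpow (Or.inl (hre k)), h5, Complex.ofReal_zero, Complex.zero_cpow h6, sub_zero,
    Complex.cpow_add _ _ hδ0, Complex.cpow_natCast]
  have h8 : w - ((r : ℂ) - k) = w - r + k := by ring
  rw [h8]
  ring

theorem differentiable_setIntegral_Ioi_cpow_smul (hδ : 0 < δ) (hK : ContinuousOn K (Ioi 0)) {σ : ℝ}
    (hσ : 0 < σ) (htop : K =O[atTop] fun t => Real.exp (-σ * t)) :
    Differentiable ℂ fun w : ℂ => ∫ t in Ioi δ, (t : ℂ) ^ (w - 1) • K t := by
  -- The tail is the Mellin transform of a function vanishing near `0`, so convergence at `0` puts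
  -- no condition on `w`.
  have heq : (fun w : ℂ => ∫ t in Ioi δ, (t : ℂ) ^ (w - 1) • K t) =
      mellin ((Ioi δ).indicator K) := by
    funext w
    unfold mellin
    have h1 : ∀ t : ℝ, (t : ℂ) ^ (w - 1) • (Ioi δ).indicator K t =
        (Ioi δ).indicator (fun t : ℝ => (t : ℂ) ^ (w - 1) • K t) t := by
      intro t
      by_cases ht : t ∈ Ioi δ <;> simp [ht]
    simp_rw [h1]
    rw [setIntegral_indicator measurableSet_Ioi]
    congr 2
    ext t
    simp only [mem_inter_iff, mem_Ioi]
    exact ⟨fun h => ⟨hδ.trans h, h⟩, fun h => h.2⟩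
  rw [heq]
  intro w
  refine mellin_differentiableAt_of_isBigO_rpow_exp (b := w.re - 1) hσ ?_ ?_ ?_ (by linarith)
  · rw [locallyIntegrableOn_iff isOpen_Ioi.isLocallyClosed]
    intro k hk hkc
    exact ((hK.locallyIntegrableOn measurableSet_Ioi).integrableOn_compact_subset hk hkc).indicator
      measurableSet_Ioi
  · refine Asymptotics.IsBigO.trans ?_ htop
    refine Asymptotics.IsBigO.of_bound 1 (Eventually.of_forall fun t => ?_)
    rw [one_mul]
    exact norm_indicator_le_norm_self _ _
  · refine (Asymptotics.isBigO_zero _ _).congr' ?_ EventuallyEq.rfl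
    filter_upwards [Ioc_mem_nhdsGT hδ] with t ht
    rw [indicator_of_notMem (by simpa using ht.2)]

theorem mellinConvergent_of_hasSum (hδ : 0 < δ) (ha : Summable fun k => ‖a k‖ * δ ^ k)
    (h : ∀ t ∈ Ioc 0 δ, HasSum (fun k => a k * (t : ℂ) ^ k) ((t : ℂ) ^ r * K t))
    (hK : ContinuousOn K (Ioi 0)) {σ : ℝ} (hσ : 0 < σ)
    (htop : K =O[atTop] fun t => Real.exp (-σ * t)) {w : ℂ} (hw : (r : ℝ) < w.re) :
    MellinConvergent K w :=
  mellinConvergent_of_isBigO_rpow_exp hσ (hK.locallyIntegrableOn measurableSet_Ioi) htop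
    (isBigO_nhdsGT_zero_of_hasSum hδ ha h) hw

/-- A Mellin transform, divided by the Gamma function, continues to `ℂ` if the function decays
exponentially at infinity and has a convergent Laurent expansion at `0`. -/
theorem exists_continuation_inv_Gamma_mul_mellin (hδ : 0 < δ)
    (ha : Summable fun k => ‖a k‖ * δ ^ k)
    (h : ∀ t ∈ Ioc 0 δ, HasSum (fun k => a k * (t : ℂ) ^ k) ((t : ℂ) ^ r * K t))
    (hK : ContinuousOn K (Ioi 0)) {σ : ℝ} (hσ : 0 < σ)
    (htop : K =O[atTop] fun t => Real.exp (-σ * t)) :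
    ∃ Z : ℂ → ℂ, MeromorphicNFOn Z univ ∧
      (∀ w : ℂ, (r : ℝ) < w.re → Z w = (Complex.Gamma w)⁻¹ * mellin K w) ∧
      AnalyticAt ℂ Z 0 ∧
      deriv Z 0 = deriv (fun w : ℂ => (Complex.Gamma (w + 1))⁻¹ * (δ : ℂ) ^ w) 0 * a r +
        ((δ : ℂ) ^ (-(r : ℂ)) *
          ∑' k : ℕ, (if k = r then 0 else a k * (δ : ℂ) ^ k) / (0 - ((r : ℂ) - k)) +
          ∫ t in Ioi δ, (t : ℂ) ^ ((0 : ℂ) - 1) • K t) := by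
  have hδ0 : (δ : ℂ) ≠ 0 := Complex.ofReal_ne_zero.mpr hδ.ne'
  set s : ℕ → ℂ := fun k => a k * (δ : ℂ) ^ k with hs
  have hsum : Summable fun k => ‖s k‖ := by
    refine ha.congr fun k => ?_
    rw [hs, norm_mul, norm_pow, Complex.norm_real, Real.norm_of_nonneg hδ.le]
  set J : ℂ → ℂ := fun w => ∫ t in Ioi δ, (t : ℂ) ^ (w - 1) • K t with hJ
  have hJd : Differentiable ℂ J := differentiable_setIntegral_Ioi_cpow_smul hδ hK hσ htop
  have hpow : Differentiable ℂ fun w : ℂ => (δ : ℂ) ^ (w - r) :=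
    (differentiable_id.sub_const _).const_cpow (Or.inl hδ0)
  set Z₀ : ℂ → ℂ := fun w => (Complex.Gamma w)⁻¹ *
    ((δ : ℂ) ^ (w - r) * ∑' k, s k / (w - ((r : ℂ) - k)) + J w) with hZ₀
  have hZm : MeromorphicOn Z₀ univ := by
    intro w hw
    exact (Complex.differentiable_one_div_Gamma.analyticAt w).meromorphicAt.fun_mul
      (((hpow.analyticAt w).meromorphicAt.fun_mul (meromorphicOn_tsum_div_sub hsum r w hw)).fun_add
        (hJd.analyticAt w).meromorphicAt)
  have hZeq : ∀ w : ℂ, (r : ℝ) < w.re → Z₀ w = (Complex.Gamma w)⁻¹ * mellin K w := by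
    intro w hw
    have hconv := mellinConvergent_of_hasSum hδ ha h hK hσ htop hw
    rw [hZ₀]
    simp only
    rw [mellin, ← Ioc_union_Ioi_eq_Ioi hδ.le, setIntegral_union (Ioc_disjoint_Ioi le_rfl)
      measurableSet_Ioi (hconv.mono_set Ioc_subset_Ioi_self)
      (hconv.mono_set (Ioi_subset_Ioi hδ.le)), setIntegral_Ioc_cpow_smul_of_hasSum hδ ha h hw]
  have hZan : ∀ w : ℂ, (r : ℝ) < w.re → AnalyticAt ℂ Z₀ w := by
    intro w hw
    have hopen : IsOpen {z : ℂ | (r : ℝ) < z.re} := isOpen_lt continuous_const Complex.continuous_re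
    refine DifferentiableOn.analyticAt (s := {z : ℂ | (r : ℝ) < z.re}) ?_ (hopen.mem_nhds hw)
    have hd : DifferentiableOn ℂ (fun z => (Complex.Gamma z)⁻¹ * mellin K z)
        {z : ℂ | (r : ℝ) < z.re} := fun z hz =>
      ((Complex.differentiable_one_div_Gamma z).mul
        (mellin_differentiableAt_of_isBigO_rpow_exp hσ (hK.locallyIntegrableOn measurableSet_Ioi)
          htop (isBigO_nhdsGT_zero_of_hasSum hδ ha h) hz)).differentiableWithinAt
    exact hd.congr fun z hz => hZeq z hz
  -- the regular part at `0`
  set s' : ℕ → ℂ := fun k => if k = r then 0 else s k with hs'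
  have hsum' : Summable fun k => ‖s' k‖ := by
    refine Summable.of_nonneg_of_le (fun _ => norm_nonneg _) (fun k => ?_) hsum
    simp only [hs']
    split_ifs <;> simp
  have hsep : ∀ w ∈ Metric.ball (0 : ℂ) (1 / 2), ∀ k, s' k ≠ 0 →
      1 / 2 ≤ ‖w - ((r : ℂ) - k)‖ := by
    intro w hw k hk
    have hkr : k ≠ r := by
      rintro rfl
      simp [hs'] at hk
    rw [mem_ball_zero_iff] at hw
    have h1 : (1 : ℝ) ≤ ‖((r : ℂ) - k)‖ := by
      have h2 : ((r : ℂ) - k) = (((r : ℤ) - k : ℤ) : ℂ) := by push_cast; rfl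
      rw [h2, Complex.norm_intCast]
      have h3 : ((r : ℤ) - k : ℤ) ≠ 0 := by omega
      exact_mod_cast Int.one_le_abs h3
    have h4 := norm_sub_norm_le ((r : ℂ) - k) w
    rw [norm_sub_rev _ w] at h4
    linarith
  set R : ℂ → ℂ := fun w => ∑' k, s' k / (w - ((r : ℂ) - k)) with hR
  have hball : Metric.ball (0 : ℂ) (1 / 2) ∈ 𝓝 (0 : ℂ) := Metric.ball_mem_nhds _ (by norm_num)
  have hRan : AnalyticAt ℂ R 0 :=
    (differentiableOn_tsum_div_sub hsum' Metric.isOpen_ball hsep).analyticAt hball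
  set A : ℂ → ℂ := fun w => (Complex.Gamma (w + 1))⁻¹ * (δ : ℂ) ^ w with hA
  have hG1 : Differentiable ℂ fun w : ℂ => (Complex.Gamma (w + 1))⁻¹ :=
    Complex.differentiable_one_div_Gamma.comp (differentiable_id.add_const 1)
  have hAd : Differentiable ℂ A := hG1.mul (differentiable_id.const_cpow (Or.inl hδ0))
  set B : ℂ → ℂ := fun w => (Complex.Gamma (w + 1))⁻¹ * ((δ : ℂ) ^ (w - r) * R w + J w) with hB
  have hBan : AnalyticAt ℂ B 0 := (hG1.analyticAt 0).fun_mul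
    (((hpow.analyticAt 0).fun_mul hRan).fun_add (hJd.analyticAt 0))
  -- Writing `1/Γ(w) = w/Γ(w+1)` turns the polar term `a r · δ^w / w` into `A w * a r` and leaves a
  -- factor `w` on the rest, so the derivative at `0` is `A'(0) a r + B(0)`.
  set Y : ℂ → ℂ := fun w => A w * a r + w * B w with hY
  have hYan : AnalyticAt ℂ Y 0 :=
    ((hAd.analyticAt 0).fun_mul analyticAt_const).fun_add (analyticAt_id.fun_mul hBan)
  have hYeq : Z₀ =ᶠ[𝓝[≠] 0] Y := by
    filter_upwards [mem_nhdsWithin_of_mem_nhds hball, self_mem_nhdsWithin] with w hw hw0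
    have hw0' : w ≠ 0 := hw0
    have hsm : Summable (Function.update (fun k => s k / (w - ((r : ℂ) - k))) r 0) := by
      refine (summable_div_sub hsum' (hsep w hw)).congr fun k => ?_
      by_cases hk : k = r <;> simp [hs', hk]
    have h1 : ∑' k, s k / (w - ((r : ℂ) - k)) = s r / w + R w := by
      rw [Summable.tsum_eq_add_tsum_ite' r hsm]
      congr 1
      · simp
      · refine tsum_congr fun k => ?_
        by_cases hk : k = r <;> simp [hs', hk]
    have h2 : (Complex.Gamma w)⁻¹ = w * (Complex.Gamma (w + 1))⁻¹ := by
      rw [Complex.Gamma_add_one w hw0', mul_inv, ← mul_assoc, mul_inv_cancel₀ hw0', one_mul]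
    have h3 : (δ : ℂ) ^ (w - r) * (δ : ℂ) ^ r = (δ : ℂ) ^ w := by
      rw [← Complex.cpow_natCast, ← Complex.cpow_add _ _ hδ0, sub_add_cancel]
    simp only [hZ₀, hY, hA, hB]
    rw [h1, h2, ← h3]
    simp only [hs]
    field_simp
    ring
  refine ⟨toMeromorphicNFOn Z₀ univ, meromorphicNFOn_toMeromorphicNFOn _ _, fun w hw => ?_, ?_, ?_⟩
  · rw [← hZeq w hw]
    exact (hZm.toMeromorphicNFOn_eventuallyEq_nhds (hZan w hw) EventuallyEq.rfl).eq_of_nhds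
  · exact hYan.congr (hZm.toMeromorphicNFOn_eventuallyEq_nhds hYan hYeq).symm
  · rw [(hZm.toMeromorphicNFOn_eventuallyEq_nhds hYan hYeq).deriv_eq]
    have h1 : HasDerivAt Y (deriv A 0 * a r + (1 * B 0 + 0 * deriv B 0)) 0 :=
      ((hAd 0).hasDerivAt.mul_const _).add
        ((hasDerivAt_id (0 : ℂ)).mul hBan.differentiableAt.hasDerivAt)
    rw [h1.deriv]
    simp only [hB, hJ, hR, zero_add, one_mul, zero_mul, add_zero, Complex.Gamma_one, inv_one,
      zero_sub]
    rfl

end MellinContinuation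

/-! ### The multiple Hurwitz zeta function with equal periods -/

section MultipleHurwitz

open MeasureTheory Set Filter Topology

theorem isOpen_re_pos : IsOpen {z : ℂ | 0 < z.re} :=
  isOpen_lt continuous_const Complex.continuous_re

theorem mellinConvergent_multipleKernel {c : ℝ} (hc : 0 < c) {r : ℕ} {x w : ℂ} (hx : 0 < x.re)
    (hw : (r : ℝ) < w.re) : MellinConvergent (multipleKernel r c x) w := by
  obtain ⟨δ, hδ, b, hb, hsum⟩ := exists_hasSum_kernel hc r
  obtain ⟨A, hA, hAle⟩ := exists_bound_expMulCoeff hδ hb ‖x‖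
  refine mellinConvergent_of_hasSum (a := expMulCoeff b x) hδ ?_ (fun t ht => ?_)
    (continuousOn_multipleKernel hc r x) hx (multipleKernel_isBigO_atTop hc r x) hw
  · exact Summable.of_nonneg_of_le (fun k => by positivity) (hAle x le_rfl) hA
  · have := hasSum_expMulCoeff hb ht (hsum t ht) x
    rwa [mul_left_comm] at this

theorem differentiableAt_setIntegral_multipleKernel {c δ : ℝ} (hc : 0 < c) (hδ : 0 < δ) (r : ℕ)
    {x₀ : ℂ} (hx : 0 < x₀.re) :
    DifferentiableAt ℂ
      (fun x : ℂ => ∫ t in Ioi δ, (t : ℂ) ^ ((0 : ℂ) - 1) • multipleKernel r c x t) x₀ := by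
  have hsub : Ioi δ ⊆ Ioi (0 : ℝ) := Ioi_subset_Ioi hδ.le
  have heq : ∀ (x : ℂ) (t : ℝ), (t : ℂ) ^ ((0 : ℂ) - 1) • multipleKernel r c x t =
      Complex.exp (-(x * t)) * ((t : ℂ) ^ ((0 : ℂ) - 1) *
        (((1 - Real.exp (-(c * t))) ^ r : ℝ) : ℂ)⁻¹) := by
    intro x t
    rw [multipleKernel, smul_eq_mul]
    ring
  simp_rw [heq]
  refine differentiableAt_laplace measurableSet_Ioi hsub (σ := x₀.re / 2) ?_ (by linarith)
  set σ : ℝ := x₀.re / 2 with hσ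
  have hσ0 : 0 < σ := by rw [hσ]; linarith
  have h1 : IntegrableOn (fun t : ℝ => δ⁻¹ * (((1 - Real.exp (-(c * δ))) ^ r)⁻¹ *
      Real.exp (-σ * t))) (Ioi δ) :=
    ((exp_neg_integrableOn_Ioi δ hσ0).const_mul _).const_mul _
  have h2 : IntegrableOn (fun t : ℝ => (t : ℂ) ^ ((0 : ℂ) - 1) • multipleKernel r c σ t)
      (Ioi δ) := by
    refine Integrable.mono' h1 ?_ ?_
    · refine ContinuousOn.aestronglyMeasurable ?_ measurableSet_Ioi
      simp only [smul_eq_mul]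
      refine ContinuousOn.mul (fun t ht => ?_) ((continuousOn_multipleKernel hc r σ).mono hsub)
      exact (Complex.continuousAt_ofReal_cpow_const t _ (Or.inr (hsub ht).ne')).continuousWithinAt
    · filter_upwards [ae_restrict_mem measurableSet_Ioi] with t ht
      have ht' : δ < t := ht
      rw [norm_smul, Complex.norm_cpow_eq_rpow_re_of_pos (hsub ht)]
      have h3 := norm_multipleKernel_le hc hδ ht'.le r (σ : ℂ)
      rw [Complex.ofReal_re] at h3
      have h4 : t ^ ((0 : ℂ) - 1).re ≤ δ⁻¹ := by
        simp only [zero_sub, Complex.neg_re, Complex.one_re, Real.rpow_neg_one]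
        gcongr
      gcongr
  exact h2.congr_fun (fun t _ => heq σ t) measurableSet_Ioi

/-- The continuation in `w` of `Γ(w)⁻¹` times the Mellin transform of the kernel; its derivative at
`w = 0` is holomorphic in `x`. -/
theorem exists_multipleKernel_continuation {c : ℝ} (hc : 0 < c) (r : ℕ) :
    ∃ D : ℂ → ℂ, DifferentiableOn ℂ D {x : ℂ | 0 < x.re} ∧ ∀ x : ℂ, 0 < x.re →
      ∃ Z : ℂ → ℂ, MeromorphicNFOn Z univ ∧
        (∀ w : ℂ, (r : ℝ) < w.re → Z w = (Complex.Gamma w)⁻¹ * mellin (multipleKernel r c x) w) ∧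
        AnalyticAt ℂ Z 0 ∧ deriv Z 0 = D x := by
  obtain ⟨δ, hδ, b, hb, hsum⟩ := exists_hasSum_kernel hc r
  -- The witness is the explicit derivative at `0`. Since `δ` and `b` do not depend on `x`, its
  -- holomorphy can be checked term by term.
  refine ⟨fun x => deriv (fun w : ℂ => (Complex.Gamma (w + 1))⁻¹ * (δ : ℂ) ^ w) 0 *
      expMulCoeff b x r + ((δ : ℂ) ^ (-(r : ℂ)) *
        ∑' k : ℕ, (if k = r then 0 else expMulCoeff b x k * (δ : ℂ) ^ k) / (0 - ((r : ℂ) - k)) +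
        ∫ t in Ioi δ, (t : ℂ) ^ ((0 : ℂ) - 1) • multipleKernel r c x t), fun x₀ hx₀ => ?_,
    fun x hx => ?_⟩
  · have hser : DifferentiableAt ℂ (fun x => ∑' k : ℕ, (if k = r then 0 else
        expMulCoeff b x k * (δ : ℂ) ^ k) / (0 - ((r : ℂ) - k))) x₀ := by
      obtain ⟨A, hA, hAle⟩ := exists_bound_expMulCoeff hδ hb (‖x₀‖ + 1)
      have hx₀b : x₀ ∈ Metric.ball (0 : ℂ) (‖x₀‖ + 1) := by simp
      refine (Complex.differentiableOn_tsum_of_summable_norm hA (fun k => ?_) Metric.isOpen_ball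
        (fun k x hx => ?_)).differentiableAt (Metric.isOpen_ball.mem_nhds hx₀b)
      · refine Differentiable.differentiableOn (Differentiable.div_const ?_ _)
        split_ifs
        · fun_prop
        · exact (differentiable_expMulCoeff b k).mul_const _
      · rw [mem_ball_zero_iff] at hx
        refine le_trans ?_ (hAle x hx.le k)
        split_ifs with hk
        · rw [zero_div, norm_zero]
          positivity
        · have h1 : (1 : ℝ) ≤ ‖(0 - ((r : ℂ) - k))‖ := by
            have h2 : (0 - ((r : ℂ) - k)) = (((k : ℤ) - r : ℤ) : ℂ) := by push_cast; ring
            rw [h2, Complex.norm_intCast]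
            have h3 : ((k : ℤ) - r : ℤ) ≠ 0 := by omega
            exact_mod_cast Int.one_le_abs h3
          rw [norm_div, norm_mul, norm_pow, Complex.norm_real, Real.norm_of_nonneg hδ.le]
          exact div_le_self (by positivity) h1
    exact (((differentiable_expMulCoeff b r x₀).const_mul _).add ((hser.const_mul _).add
      (differentiableAt_setIntegral_multipleKernel hc hδ r hx₀))).differentiableWithinAt
  · obtain ⟨A, hA, hAle⟩ := exists_bound_expMulCoeff hδ hb ‖x‖
    refine exists_continuation_inv_Gamma_mul_mellin (a := expMulCoeff b x) hδ ?_ (fun t ht => ?_)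
      (continuousOn_multipleKernel hc r x) hx (multipleKernel_isBigO_atTop hc r x)
    · exact Summable.of_nonneg_of_le (fun k => by positivity) (hAle x le_rfl) hA
    · have := hasSum_expMulCoeff hb ht (hsum t ht) x
      rwa [mul_left_comm] at this

theorem hasSum_pow_sum {q : ℝ} (h0 : 0 ≤ q) (h1 : q < 1) (r : ℕ) :
    HasSum (fun n : Fin r → ℕ => q ^ ∑ i, n i) (((1 - q) ^ r)⁻¹) := by
  induction r with
  | zero => simp
  | succ r ih =>
    have hg := hasSum_geometric_of_lt_one h0 h1
    have hs : Summable fun p : ℕ × (Fin r → ℕ) => q ^ p.1 * q ^ ∑ i, p.2 i :=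
      Summable.mul_of_nonneg (f := fun n : ℕ => q ^ n) (g := fun n : Fin r → ℕ => q ^ ∑ i, n i)
        hg.summable ih.summable (Pi.le_def.mpr fun n => pow_nonneg h0 n)
        (Pi.le_def.mpr fun n => pow_nonneg h0 (∑ i, n i))
    have h : HasSum (fun p : ℕ × (Fin r → ℕ) => q ^ p.1 * q ^ ∑ i, p.2 i)
        ((1 - q)⁻¹ * ((1 - q) ^ r)⁻¹) :=
      HasSum.mul (f := fun n : ℕ => q ^ n) (g := fun n : Fin r → ℕ => q ^ ∑ i, n i) hg ih hs
    let e : ℕ × (Fin r → ℕ) ≃ (Fin (r + 1) → ℕ) := Fin.consEquiv (fun _ => ℕ)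
    have he : (fun p : ℕ × (Fin r → ℕ) => q ^ p.1 * q ^ ∑ i, p.2 i) =
        (fun n : Fin (r + 1) → ℕ => q ^ ∑ i, n i) ∘ e := by
      funext p
      simp [e, Fin.consEquiv, Fin.sum_univ_succ, pow_add]
    rw [pow_succ', mul_inv, ← e.hasSum_iff, ← he]
    exact h

/-- Each term is a Gamma integral, and under the integral sign the terms form a product of `r`
geometric series that sums to the kernel. -/
theorem hasSum_multipleHurwitzTerm {c : ℝ} (hc : 0 < c) {r : ℕ} {x w : ℂ} (hx : 0 < x.re)
    (hw : (r : ℝ) < w.re) :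
    HasSum (multipleHurwitzTerm w x (fun _ : Fin r => c))
      ((Complex.Gamma w)⁻¹ * mellin (multipleKernel r c x) w) := by
  have hw0 : 0 < w.re := (Nat.cast_nonneg r).trans_lt hw
  set F : (Fin r → ℕ) → ℝ → ℂ := fun n t =>
    Complex.exp (-(((∑ i, (n i : ℂ) * (c : ℂ)) + x) * t)) * (t : ℂ) ^ (w - 1) with hF
  have hexp : ∀ (n : Fin r → ℕ) (t : ℝ), Complex.exp (-(((∑ i, (n i : ℂ) * (c : ℂ)) + x) * t)) =
      Complex.exp (-(x * t)) * ((Real.exp (-(c * t)) ^ ∑ i, n i : ℝ) : ℂ) := by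
    intro n t
    rw [Complex.ofReal_pow, Complex.ofReal_exp, ← Complex.exp_nat_mul, ← Complex.exp_add,
      ← Finset.sum_mul]
    push_cast
    ring_nf
  have hpos : ∀ n : Fin r → ℕ, 0 < ((∑ i, (n i : ℂ) * (c : ℂ)) + x).re := by
    intro n
    have h1 : (∑ i, (n i : ℂ) * (c : ℂ)) = ((∑ i, (n i : ℝ) * c : ℝ) : ℂ) := by push_cast; rfl
    have h2 : 0 ≤ ∑ i, (n i : ℝ) * c := Finset.sum_nonneg fun i _ => by positivity
    rw [h1, Complex.add_re, Complex.ofReal_re]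
    linarith
  have hmeas : ∀ n, AEStronglyMeasurable (F n) (volume.restrict (Ioi 0)) := by
    intro n
    refine ContinuousOn.aestronglyMeasurable (ContinuousOn.mul (by fun_prop) fun t ht => ?_)
      measurableSet_Ioi
    exact (Complex.continuousAt_ofReal_cpow_const t _ (Or.inr (ne_of_gt ht))).continuousWithinAt
  have hgeo : ∀ t : ℝ, 0 < t → HasSum (fun n : Fin r → ℕ => Real.exp (-(c * t)) ^ ∑ i, n i)
      (((1 - Real.exp (-(c * t))) ^ r)⁻¹) := by
    intro t ht
    exact hasSum_pow_sum (Real.exp_pos _).le (by linarith [one_sub_exp_neg_mul_pos hc ht]) r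
  have hsumF : ∀ t : ℝ, 0 < t →
      HasSum (fun n => F n t) ((t : ℂ) ^ (w - 1) • multipleKernel r c x t) := by
    intro t ht
    have h1 := (Complex.hasSum_ofReal.mpr (hgeo t ht)).mul_left
      ((t : ℂ) ^ (w - 1) * Complex.exp (-(x * t)))
    rw [multipleKernel, smul_eq_mul, ← mul_assoc, ← Complex.ofReal_inv]
    refine h1.congr_fun fun n => ?_
    simp only [hF]
    rw [hexp]
    ring
  have hnormF : ∀ t : ℝ, 0 < t →
      HasSum (fun n => ‖F n t‖) ‖(t : ℂ) ^ (w - 1) • multipleKernel r c x t‖ := by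
    intro t ht
    have h1 := (hgeo t ht).mul_left (‖(t : ℂ) ^ (w - 1)‖ * Real.exp (-(x.re * t)))
    rw [norm_smul, norm_multipleKernel hc ht, ← mul_assoc]
    refine h1.congr_fun fun n => ?_
    simp only [hF]
    rw [hexp, norm_mul, norm_mul, Complex.norm_real, Real.norm_of_nonneg (by positivity),
      Complex.norm_exp]
    simp
    ring
  -- Each term is its own majorant: the norms sum exactly to the norm of the limit, which is
  -- integrable.
  have hmain := hasSum_integral_of_dominated_convergence (μ := volume.restrict (Ioi 0))
    (F := F) (f := fun t : ℝ => (t : ℂ) ^ (w - 1) • multipleKernel r c x t)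
    (fun n t => ‖F n t‖) hmeas (fun n => Eventually.of_forall fun t => le_rfl)
    (by
      filter_upwards [ae_restrict_mem measurableSet_Ioi] with t ht
      exact (hnormF t ht).summable)
    (by
      refine (mellinConvergent_multipleKernel hc hx hw).norm.congr ?_
      filter_upwards [ae_restrict_mem measurableSet_Ioi] with t ht
      exact (hnormF t ht).tsum_eq.symm)
    (by
      filter_upwards [ae_restrict_mem measurableSet_Ioi] with t ht
      exact hsumF t ht)
  have hmain' := hmain.mul_left (Complex.Gamma w)⁻¹
  refine hmain'.congr_fun fun n => ?_
  simp only [hF]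
  rw [integral_exp_mul_cpow_Ioi hw0 (hpos n), ← mul_assoc,
    inv_mul_cancel₀ (Complex.Gamma_ne_zero_of_re_pos hw0), one_mul, multipleHurwitzTerm]

theorem multipleHurwitz_eq_of_continuation {c : ℝ} (hc : 0 < c) {r : ℕ} {x : ℂ} (hx : 0 < x.re)
    {Z : ℂ → ℂ} (hZ : MeromorphicNFOn Z univ)
    (h : ∀ w : ℂ, (r : ℝ) < w.re →
      Z w = (Complex.Gamma w)⁻¹ * mellin (multipleKernel r c x) w) :
    (fun w => multipleHurwitz w x (fun _ : Fin r => c)) = Z := by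
  refine meroCont_eq ⟨hZ, r, fun w hw => ?_⟩
  simp only
  rw [h w hw, (hasSum_multipleHurwitzTerm hc hx hw).tsum_eq]

theorem meromorphicNFOn_multipleHurwitz {c : ℝ} (hc : 0 < c) (r : ℕ) {x : ℂ} (hx : 0 < x.re) :
    MeromorphicNFOn (fun w => multipleHurwitz w x (fun _ : Fin r => c)) univ := by
  obtain ⟨D, -, h⟩ := exists_multipleKernel_continuation hc r
  obtain ⟨Z, hZ, hZeq, -, -⟩ := h x hx
  rwa [multipleHurwitz_eq_of_continuation hc hx hZ hZeq]

theorem multipleHurwitz_eq_mellin {c : ℝ} (hc : 0 < c) {r : ℕ} {x : ℂ} (hx : 0 < x.re) {w : ℂ}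
    (hw : (r : ℝ) < w.re) :
    multipleHurwitz w x (fun _ : Fin r => c) =
      (Complex.Gamma w)⁻¹ * mellin (multipleKernel r c x) w := by
  obtain ⟨D, -, h⟩ := exists_multipleKernel_continuation hc r
  obtain ⟨Z, hZ, hZeq, -, -⟩ := h x hx
  rw [congrFun (multipleHurwitz_eq_of_continuation hc hx hZ hZeq) w, hZeq w hw]

theorem analyticAt_multipleHurwitz_zero {c : ℝ} (hc : 0 < c) (r : ℕ) {x : ℂ} (hx : 0 < x.re) :
    AnalyticAt ℂ (fun w => multipleHurwitz w x (fun _ : Fin r => c)) 0 := by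
  obtain ⟨D, -, h⟩ := exists_multipleKernel_continuation hc r
  obtain ⟨Z, hZ, hZeq, hZan, -⟩ := h x hx
  rwa [multipleHurwitz_eq_of_continuation hc hx hZ hZeq]

theorem differentiableOn_deriv_multipleHurwitz {c : ℝ} (hc : 0 < c) (r : ℕ) :
    DifferentiableOn ℂ (fun x => deriv (fun w => multipleHurwitz w x (fun _ : Fin r => c)) 0)
      {x : ℂ | 0 < x.re} := by
  obtain ⟨D, hD, h⟩ := exists_multipleKernel_continuation hc r
  refine hD.congr fun x hx => ?_
  obtain ⟨Z, hZ, hZeq, -, hZD⟩ := h x hx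
  rw [multipleHurwitz_eq_of_continuation hc hx hZ hZeq, hZD]

/-- The kernel recursion passes to Mellin transforms where all three converge, `re w > r + 1`, and
then to `w = 0` by the identity theorem. -/
theorem deriv_multipleHurwitz_succ_sub {c : ℝ} (hc : 0 < c) (r : ℕ) {x : ℂ} (hx : 0 < x.re) :
    deriv (fun w => multipleHurwitz w x (fun _ : Fin (r + 1) => c)) 0 -
      deriv (fun w => multipleHurwitz w (x + c) (fun _ : Fin (r + 1) => c)) 0 =
      deriv (fun w => multipleHurwitz w x (fun _ : Fin r => c)) 0 := by
  have hxc : 0 < (x + c).re := by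
    rw [Complex.add_re, Complex.ofReal_re]
    linarith
  have h1 := analyticAt_multipleHurwitz_zero hc (r + 1) hx
  have h2 := analyticAt_multipleHurwitz_zero hc (r + 1) hxc
  have h3 := analyticAt_multipleHurwitz_zero hc r hx
  have hne := MeromorphicOn.eventuallyEq_nhdsNE_of_eqOn_halfPlane
    ((meromorphicNFOn_multipleHurwitz hc (r + 1) hx).meromorphicOn.fun_sub
      (meromorphicNFOn_multipleHurwitz hc (r + 1) hxc).meromorphicOn)
    (meromorphicNFOn_multipleHurwitz hc r hx).meromorphicOn (c := (r : ℝ) + 1)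
    (fun w hw => by
      have hw1 : ((r + 1 : ℕ) : ℝ) < w.re := by exact_mod_cast hw
      have hw2 : (r : ℝ) < w.re := by linarith
      have hsub : mellin (multipleKernel (r + 1) c x) w - mellin (multipleKernel (r + 1) c (x + c)) w
          = mellin (multipleKernel r c x) w := by
        have h4 : mellin (fun t => multipleKernel (r + 1) c x t - multipleKernel (r + 1) c (x + c) t)
            w = _ := (hasMellin_sub (mellinConvergent_multipleKernel hc hx hw1)
          (mellinConvergent_multipleKernel hc hxc hw1)).2
        rw [← h4]
        refine setIntegral_congr_fun measurableSet_Ioi fun t ht => ?_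
        simp only
        rw [multipleKernel_succ_sub hc ht]
      rw [multipleHurwitz_eq_mellin hc hx hw1, multipleHurwitz_eq_mellin hc hxc hw1,
        multipleHurwitz_eq_mellin hc hx hw2, ← mul_sub, hsub]) 0
  have heq := (h1.fun_sub h2).eventuallyEq_nhds_of_nhdsNE h3 hne
  rw [← heq.deriv_eq, deriv_fun_sub h1.differentiableAt h2.differentiableAt]

/-- With no periods the series is the single term `x^(-w)`; this starts the induction at `Γ_0(x) =
1/x`. -/
theorem deriv_multipleHurwitz_zero_periods (c : ℝ) {x : ℂ} (hx : 0 < x.re) :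
    deriv (fun w => multipleHurwitz w x (fun _ : Fin 0 => c)) 0 = -Complex.log x := by
  have hx0 : x ≠ 0 := by
    rintro rfl
    simp at hx
  have hd : Differentiable ℂ fun w : ℂ => x ^ (-w) := differentiable_id.neg.const_cpow (Or.inl hx0)
  have hZ : (fun w => multipleHurwitz w x (fun _ : Fin 0 => c)) = fun w => x ^ (-w) := by
    refine meroCont_eq ⟨fun w _ => (hd.analyticAt w).meromorphicNFAt, 0, fun w _ => ?_⟩
    simp only
    rw [tsum_eq_single (default : Fin 0 → ℕ) fun n hn => absurd (Subsingleton.elim _ _) hn]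
    simp [multipleHurwitzTerm]
  rw [hZ]
  have h1 := ((hasDerivAt_id (0 : ℂ)).neg).const_cpow (c := x) (Or.inl hx0)
  have h2 : deriv (fun w : ℂ => x ^ (-w)) 0 = _ := h1.deriv
  rw [h2]
  simp

end MultipleHurwitz

/-! ### The multiple gamma function with equal periods -/

section MultipleGamma

open Set Filter Topology

/-- A function on the right half-plane with `G x = G (x + c) H x`, where `H` is entire, is the
restriction of an entire function. -/
theorem exists_entire_extension {c : ℝ} (hc : 0 < c) {G H : ℂ → ℂ}
    (hG : DifferentiableOn ℂ G {x : ℂ | 0 < x.re}) (hH : Differentiable ℂ H)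
    (h : ∀ x : ℂ, 0 < x.re → G x = G (x + c) * H x) :
    ∃ E : ℂ → ℂ, Differentiable ℂ E ∧ ∀ (N : ℕ) (x : ℂ), 0 < x.re + c * N →
      E x = G (x + c * N) * ∏ j ∈ Finset.range N, H (x + c * j) := by
  -- `P N` iterates the relation `N` times and is holomorphic for `re x > -cN`; the `P N` agree on
  -- overlaps and glue.
  set P : ℕ → ℂ → ℂ := fun N x => G (x + c * N) * ∏ j ∈ Finset.range N, H (x + c * j) with hP
  have hre : ∀ (N : ℕ) (x : ℂ), (x + c * N).re = x.re + c * N := by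
    intro N x
    simp
  have hsucc : ∀ (N : ℕ) (x : ℂ), 0 < x.re + c * N → P (N + 1) x = P N x := by
    intro N x hx
    simp only [hP]
    rw [h (x + c * N) (by rwa [hre]), Finset.prod_range_succ]
    push_cast
    ring_nf
  have hadd : ∀ (k N : ℕ) (x : ℂ), 0 < x.re + c * N → P (N + k) x = P N x := by
    intro k N x hx
    induction k with
    | zero => rfl
    | succ k ih =>
      rw [← add_assoc, hsucc (N + k) x, ih]
      have : (0 : ℝ) ≤ c * k := by positivity
      push_cast
      linarith
  have hPP : ∀ (M N : ℕ) (x : ℂ), 0 < x.re + c * M → 0 < x.re + c * N → P M x = P N x := by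
    intro M N x hM hN
    rcases le_total M N with hMN | hMN
    · obtain ⟨k, rfl⟩ := Nat.exists_eq_add_of_le hMN
      exact (hadd k M x hM).symm
    · obtain ⟨k, rfl⟩ := Nat.exists_eq_add_of_le hMN
      exact hadd k N x hN
  have hex : ∀ x : ℂ, ∃ N : ℕ, 0 < x.re + c * N := by
    intro x
    obtain ⟨N, hN⟩ := exists_nat_gt (-x.re / c)
    rw [div_lt_iff₀ hc] at hN
    exact ⟨N, by linarith⟩
  choose ν hν using hex
  have hE : ∀ (N : ℕ) (x : ℂ), 0 < x.re + c * N → P (ν x) x = P N x :=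
    fun N x hx => hPP _ _ x (hν x) hx
  refine ⟨fun x => P (ν x) x, fun x₀ => ?_, hE⟩
  have hopen : IsOpen {x : ℂ | 0 < x.re + c * ν x₀} :=
    isOpen_lt continuous_const (Complex.continuous_re.add continuous_const)
  have heq : (fun x => P (ν x) x) =ᶠ[𝓝 x₀] P (ν x₀) := by
    filter_upwards [hopen.mem_nhds (hν x₀)] with x hx
    exact hE _ x hx
  refine DifferentiableAt.congr_of_eventuallyEq ?_ heq
  have h1 : DifferentiableAt ℂ G (x₀ + c * ν x₀) :=
    hG.differentiableAt (isOpen_re_pos.mem_nhds (by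
      simp only [mem_ofPred_eq]
      rw [hre]
      exact hν x₀))
  have h2 : DifferentiableAt ℂ (fun x : ℂ => G (x + c * ν x₀)) x₀ :=
    h1.comp x₀ (differentiableAt_id.add_const _)
  refine h2.mul (DifferentiableAt.fun_finsetProd fun j _ => ?_)
  exact (hH _).comp x₀ (differentiableAt_id.add_const _)

/-- The reciprocal of the multiple gamma function is entire, with zeros at most at
`0, -c, -2c, …`. -/
theorem exists_entire_inv_multipleGamma {c : ℝ} (hc : 0 < c) (r : ℕ) :
    ∃ E : ℂ → ℂ, Differentiable ℂ E ∧
      (∀ x : ℂ, 0 < x.re →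
        E x = Complex.exp (-deriv (fun w => multipleHurwitz w x (fun _ : Fin r => c)) 0)) ∧
      ∀ x : ℂ, (∀ k : ℕ, x ≠ -(c * k)) → E x ≠ 0 := by
  induction r with
  | zero =>
    refine ⟨id, differentiable_id, fun x hx => ?_, fun x hx => by simpa using hx 0⟩
    rw [deriv_multipleHurwitz_zero_periods c hx, neg_neg, Complex.exp_log]
    · rfl
    · rintro rfl
      simp at hx
  | succ r ih =>
    obtain ⟨H, hH, hHeq, hHne⟩ := ih
    have hG : DifferentiableOn ℂ (fun x => Complex.exp (-deriv (fun w =>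
        multipleHurwitz w x (fun _ : Fin (r + 1) => c)) 0)) {x : ℂ | 0 < x.re} :=
      (differentiableOn_deriv_multipleHurwitz hc (r + 1)).fun_neg.cexp
    obtain ⟨E, hE, hEeq⟩ := exists_entire_extension hc hG hH (fun x hx => by
      rw [hHeq x hx, ← Complex.exp_add, ← deriv_multipleHurwitz_succ_sub hc r hx]
      ring_nf)
    refine ⟨E, hE, fun x hx => ?_, fun x hx => ?_⟩
    · have := hEeq 0 x (by simpa using hx)
      simpa using this
    · obtain ⟨N, hN⟩ := exists_nat_gt (-x.re / c)
      rw [div_lt_iff₀ hc] at hN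
      rw [hEeq N x (by linarith)]
      -- After shifting into the half-plane the `G` factor is an exponential, so a zero comes from
      -- some `x + c j = -c k`, that is `x = -c (k + j)`.
      refine mul_ne_zero (Complex.exp_ne_zero _) (Finset.prod_ne_zero_iff.mpr fun j _ => ?_)
      refine hHne _ fun k hk => hx (k + j) ?_
      push_cast
      linear_combination hk

/-- The pointwise inverse of an entire function is already in normal form: the value `0⁻¹ = 0` is
the one prescribed at poles. -/
theorem exists_multipleGamma_eq_inv {c : ℝ} (hc : 0 < c) (r : ℕ) :
    ∃ E : ℂ → ℂ, Differentiable ℂ E ∧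
      (fun x => multipleGamma x (fun _ : Fin r => c)) = E⁻¹ ∧
      (∀ x : ℂ, 0 < x.re → (E x)⁻¹ =
        Complex.exp (deriv (fun w => multipleHurwitz w x (fun _ : Fin r => c)) 0)) ∧
      ∀ x : ℂ, (∀ k : ℕ, x ≠ -(c * k)) → E x ≠ 0 := by
  obtain ⟨E, hE, hEeq, hne⟩ := exists_entire_inv_multipleGamma hc r
  have hinv : ∀ x : ℂ, 0 < x.re → (E x)⁻¹ =
      Complex.exp (deriv (fun w => multipleHurwitz w x (fun _ : Fin r => c)) 0) := by
    intro x hx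
    rw [hEeq x hx, Complex.exp_neg, inv_inv]
  refine ⟨E, hE, meroCont_eq ⟨fun x _ => (hE.analyticAt x).meromorphicNFAt.inv, 0, hinv⟩, hinv, hne⟩

theorem meromorphicNFOn_multipleGamma {c : ℝ} (hc : 0 < c) (r : ℕ) :
    MeromorphicNFOn (fun x => multipleGamma x (fun _ : Fin r => c)) univ := by
  obtain ⟨E, hE, heq, -, -⟩ := exists_multipleGamma_eq_inv hc r
  rw [heq]
  exact fun x _ => (hE.analyticAt x).meromorphicNFAt.inv

theorem multipleGamma_eq_exp {c : ℝ} (hc : 0 < c) (r : ℕ) {x : ℂ} (hx : 0 < x.re) :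
    multipleGamma x (fun _ : Fin r => c) =
      Complex.exp (deriv (fun w => multipleHurwitz w x (fun _ : Fin r => c)) 0) := by
  obtain ⟨E, -, heq, hinv, -⟩ := exists_multipleGamma_eq_inv hc r
  rw [congrFun heq x, ← hinv x hx]
  rfl

theorem multipleGamma_ne_zero {c : ℝ} (hc : 0 < c) (r : ℕ) {x : ℂ} (hx : ∀ k : ℕ, x ≠ -(c * k)) :
    multipleGamma x (fun _ : Fin r => c) ≠ 0 := by
  obtain ⟨E, -, heq, -, hne⟩ := exists_multipleGamma_eq_inv hc r
  rw [congrFun heq x]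
  exact inv_ne_zero (hne x hx)

end MultipleGamma

/-! ### The absolute zeta function of the Grover walk -/

section AbsoluteZeta

open MeasureTheory Set Filter Topology

/-- The substitution `x = e ^ t` in the integrand of the absolute Hurwitz zeta function of
`(1 - x ^ m)^(-r)`. -/
theorem exp_smul_absHurwitzIntegrand {m r : ℕ} {f : ℝ → ℂ}
    (hf : ∀ x : ℝ, f x = ((1 - (x : ℂ) ^ m) ^ r)⁻¹) (w s : ℂ) (t : ℝ) :
    Real.exp t • absHurwitzIntegrand f w s (Real.exp t) =
      (-1) ^ r * ((t : ℂ) ^ (w - 1) • multipleKernel r m (s + m * r) t) := by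
  have hexp : ((Real.exp t : ℝ) : ℂ) = Complex.exp t := Complex.ofReal_exp t
  have hcpow : ((Real.exp t : ℝ) : ℂ) ^ (-s - 1) = Complex.exp (t * (-s - 1)) := by
    rw [Complex.cpow_def_of_ne_zero (by rw [hexp]; exact Complex.exp_ne_zero _),
      ← Complex.ofReal_log (Real.exp_pos t).le, Real.log_exp]
  have hq : Complex.exp (m * t) * Complex.exp (-(m * t)) = 1 := by
    rw [← Complex.exp_add, add_neg_cancel, Complex.exp_zero]
  -- Factoring out `-e^(mt)` produces, after the `r`-th power, both the sign `(-1)^r` and the shift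
  -- of `s` by `m r`.
  have hfac : 1 - Complex.exp t ^ m =
      (-1) * (Complex.exp (m * t) * (1 - Complex.exp (-(m * t)))) := by
    rw [← Complex.exp_nat_mul]
    linear_combination -hq
  have hprod : Complex.exp t * Complex.exp (t * (-s - 1)) * (Complex.exp (m * t) ^ r)⁻¹ =
      Complex.exp (-((s + m * r) * t)) := by
    rw [← Complex.exp_nat_mul, ← Complex.exp_neg, ← Complex.exp_add, ← Complex.exp_add]
    ring_nf
  have hsign : (((-1 : ℂ)) ^ r)⁻¹ = (-1) ^ r := by
    rw [← inv_pow, inv_neg, inv_one]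
  rw [absHurwitzIntegrand, hf, hcpow, Real.log_exp, hexp, hfac, multipleKernel, Complex.real_smul,
    hexp, smul_eq_mul, mul_pow, mul_pow, mul_inv, mul_inv, hsign, ← hprod]
  push_cast
  ring

variable {m r : ℕ} {f : ℝ → ℂ}

theorem integrableOn_absHurwitzIntegrand (hm : 0 < m)
    (hf : ∀ x : ℝ, f x = ((1 - (x : ℂ) ^ m) ^ r)⁻¹) {w s : ℂ} (hs : 0 < (s + m * r).re)
    (hw : (r : ℝ) < w.re) : IntegrableOn (absHurwitzIntegrand f w s) (Ioi 1) := by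
  have h := integrableOn_comp_exp_Ioi (absHurwitzIntegrand f w s) 0
  rw [Real.exp_zero] at h
  rw [← h]
  have hc := mellinConvergent_multipleKernel (c := m) (by exact_mod_cast hm) hs hw
  refine IntegrableOn.congr_fun (hc.const_mul ((-1) ^ r)) (fun t _ => ?_) measurableSet_Ioi
  exact (exp_smul_absHurwitzIntegrand hf w s t).symm

theorem absHurwitzIntegral_eq (hm : 0 < m) (hf : ∀ x : ℝ, f x = ((1 - (x : ℂ) ^ m) ^ r)⁻¹)
    {w s : ℂ} (hs : 0 < (s + m * r).re) (hw : (r : ℝ) < w.re) :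
    absHurwitzIntegral f w s =
      (-1) ^ r * multipleHurwitz w (s + m * r) (fun _ : Fin r => (m : ℝ)) := by
  have h := integral_comp_exp_Ioi (absHurwitzIntegrand f w s) 0
  rw [Real.exp_zero] at h
  have hc : (0 : ℝ) < m := by exact_mod_cast hm
  rw [absHurwitzIntegral, ← h, multipleHurwitz_eq_mellin hc hs hw, mellin, mul_left_comm]
  congr 1
  rw [← integral_const_mul]
  exact integral_congr_ae (Eventually.of_forall (exp_smul_absHurwitzIntegrand hf w s))

theorem meromorphicNFOn_const_mul {g : ℂ → ℂ} {a : ℂ} (ha : a ≠ 0) (hg : MeromorphicNFOn g univ) :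
    MeromorphicNFOn (fun w => a * g w) univ := fun _ hw =>
  (meromorphicNFAt_mul_iff_right (f := g) (g := fun _ => a) analyticAt_const ha).mpr (hg hw)

theorem absHurwitz_eq (hm : 0 < m) (hf : ∀ x : ℝ, f x = ((1 - (x : ℂ) ^ m) ^ r)⁻¹) {s : ℂ}
    (hs : 0 < (s + m * r).re) :
    (fun w => absHurwitz f w s) =
      fun w => (-1) ^ r * multipleHurwitz w (s + m * r) (fun _ : Fin r => (m : ℝ)) := by
  have hc : (0 : ℝ) < m := by exact_mod_cast hm
  refine meroCont_eq ⟨meromorphicNFOn_const_mul (pow_ne_zero r (by norm_num))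
    (meromorphicNFOn_multipleHurwitz hc r hs), r,
    fun _ hw => (absHurwitzIntegral_eq hm hf hs hw).symm⟩

theorem exp_neg_one_pow_mul (r : ℕ) (z : ℂ) :
    Complex.exp ((-1) ^ r * z) = Complex.exp z ^ ((-1 : ℤ) ^ r) := by
  rcases Nat.even_or_odd r with h | h
  · simp [h.neg_one_pow]
  · simp [h.neg_one_pow, Complex.exp_neg]

theorem exp_deriv_absHurwitz (hm : 0 < m) (hf : ∀ x : ℝ, f x = ((1 - (x : ℂ) ^ m) ^ r)⁻¹) {s : ℂ}
    (hs : 0 < (s + m * r).re) :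
    Complex.exp (deriv (fun w => absHurwitz f w s) 0) =
      multipleGamma (s + m * r) (fun _ : Fin r => (m : ℝ)) ^ ((-1 : ℤ) ^ r) := by
  have hc : (0 : ℝ) < m := by exact_mod_cast hm
  rw [absHurwitz_eq hm hf hs,
    deriv_const_mul _ (analyticAt_multipleHurwitz_zero hc r hs).differentiableAt, exp_neg_one_pow_mul,
    multipleGamma_eq_exp hc r hs]

theorem meromorphicNFOn_multipleGamma_shift_zpow {c : ℝ} (hc : 0 < c) (r : ℕ) (a : ℂ) (n : ℤ) :
    MeromorphicNFOn (fun s => multipleGamma (s + a) (fun _ : Fin r => c) ^ n) univ := by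
  intro s _
  have h1 : MeromorphicNFAt (fun s => multipleGamma (s + a) (fun _ : Fin r => c)) s :=
    meromorphicNFAt_comp_add_const_iff_meromorphicNFAt.mpr
      (meromorphicNFOn_multipleGamma hc r (mem_univ _))
  exact h1.zpow

theorem absZeta_eq (hm : 0 < m) (hf : ∀ x : ℝ, f x = ((1 - (x : ℂ) ^ m) ^ r)⁻¹) :
    absZeta f =
      fun s => multipleGamma (s + m * r) (fun _ : Fin r => (m : ℝ)) ^ ((-1 : ℤ) ^ r) := by
  have hc : (0 : ℝ) < m := by exact_mod_cast hm
  refine meroCont_eq ⟨meromorphicNFOn_multipleGamma_shift_zpow hc r _ _, -(m * r : ℝ),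
    fun s hs => ?_⟩
  refine (exp_deriv_absHurwitz hm hf ?_).symm
  simp
  linarith

end AbsoluteZeta

/-! ### Automorphy and the functional equation -/

theorem bipartiteForm_eq {n₁ n₂ r : ℕ} (hn : (n₁ = 1 ∧ n₂ = 2) ∨ (n₁ = 2 ∧ 2 ≤ n₂))
    (hr : r + 2 = n₁ + n₂) (x : ℝ) : bipartiteForm n₁ n₂ x = ((1 - (x : ℂ) ^ 4) ^ r)⁻¹ :=
  bipartiteGroverZeta_eq hn hr x

/-- This is `1 - x^(-m) = -x^(-m) (1 - x^m)` raised to the power `-r`. It also holds at real `x`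
with `x^m = 1`, where inverting the same vanishing factor gives equal values on both sides. -/
theorem isAbsoluteAutomorphicForm_inv_one_sub_pow {m r : ℕ} {f : ℝ → ℂ}
    (hf : ∀ x : ℝ, f x = ((1 - (x : ℂ) ^ m) ^ r)⁻¹) :
    IsAbsoluteAutomorphicForm f ((-1) ^ r) (-(m * r)) := by
  refine ⟨neg_one_pow_eq_or ℤ r, fun x hx => ?_⟩
  have hx' : (x : ℂ) ≠ 0 := Complex.ofReal_ne_zero.mpr hx
  have h1 : 1 - ((1 / x : ℝ) : ℂ) ^ m = (-1) * (((x : ℂ) ^ m)⁻¹ * (1 - (x : ℂ) ^ m)) := by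
    push_cast
    rw [one_div, inv_pow, mul_sub, inv_mul_cancel₀ (pow_ne_zero m hx')]
    ring
  have h2 : (x : ℂ) ^ (-(-((m : ℤ) * r))) = ((x : ℂ) ^ m) ^ r := by
    rw [neg_neg, zpow_mul, zpow_natCast, zpow_natCast]
  rw [hf, hf, h1, h2, mul_pow, mul_pow, mul_inv, mul_inv, ← inv_pow, inv_neg, inv_one, inv_pow,
    inv_inv]
  push_cast
  ring

theorem proposition5 (n₁ n₂ r : ℕ) (hn : (n₁ = 1 ∧ n₂ = 2) ∨ (n₁ = 2 ∧ 2 ≤ n₂))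
    (hr : r + 2 = n₁ + n₂) :
    -- the zeta function of the Grover walk
    (∀ u : ℂ, u ^ 4 ≠ 1 →
      bipartiteGroverZeta n₁ n₂ u = (-1) ^ (n₁ + n₂) / (u ^ 4 - 1) ^ r) ∧
    IsAbsoluteAutomorphicForm (bipartiteForm n₁ n₂) ((-1) ^ (n₁ + n₂)) (-(4 * r)) ∧
    -- the multiple Hurwitz zeta function and the multiple gamma function are well defined
    (∀ x : ℂ, 0 < x.re →
      (∀ w : ℂ, (r : ℝ) < w.re →
        Summable (multipleHurwitzTerm w x (fun _ : Fin r => (4 : ℝ))) ∧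
        multipleHurwitz w x (fun _ : Fin r => (4 : ℝ)) =
          ∑' n : Fin r → ℕ, multipleHurwitzTerm w x (fun _ => (4 : ℝ)) n) ∧
      MeromorphicNFOn (fun w => multipleHurwitz w x (fun _ : Fin r => (4 : ℝ))) Set.univ ∧
      AnalyticAt ℂ (fun w => multipleHurwitz w x (fun _ : Fin r => (4 : ℝ))) 0 ∧
      multipleGamma x (fun _ : Fin r => (4 : ℝ)) =
        Complex.exp (deriv (fun w => multipleHurwitz w x (fun _ : Fin r => (4 : ℝ))) 0)) ∧
    MeromorphicNFOn (fun x => multipleGamma x (fun _ : Fin r => (4 : ℝ))) Set.univ ∧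
    -- the absolute Hurwitz zeta function and the absolute zeta function are well defined
    (∀ s : ℂ, -(4 * (r : ℝ)) < s.re →
      (∀ w : ℂ, (r : ℝ) < w.re →
        MeasureTheory.IntegrableOn (absHurwitzIntegrand (bipartiteForm n₁ n₂) w s)
          (Set.Ioi (1 : ℝ)) ∧
        absHurwitz (bipartiteForm n₁ n₂) w s =
          absHurwitzIntegral (bipartiteForm n₁ n₂) w s) ∧
      MeromorphicNFOn (fun w => absHurwitz (bipartiteForm n₁ n₂) w s) Set.univ ∧
      AnalyticAt ℂ (fun w => absHurwitz (bipartiteForm n₁ n₂) w s) 0 ∧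
      absZeta (bipartiteForm n₁ n₂) s =
        Complex.exp (deriv (fun w => absHurwitz (bipartiteForm n₁ n₂) w s) 0)) ∧
    MeromorphicNFOn (absZeta (bipartiteForm n₁ n₂)) Set.univ ∧
    -- the absolute Hurwitz zeta function as a multiple Hurwitz zeta function
    (∀ s : ℂ, -(4 * (r : ℝ)) < s.re → ∀ w : ℂ,
      absHurwitz (bipartiteForm n₁ n₂) w s =
        (-1) ^ (n₁ + n₂) * multipleHurwitz w (s + 4 * r) (fun _ : Fin r => (4 : ℝ))) ∧
    -- the absolute zeta function as a power of a multiple gamma function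
    (∀ s : ℂ, absZeta (bipartiteForm n₁ n₂) s =
      multipleGamma (s + 4 * r) (fun _ : Fin r => (4 : ℝ)) ^ ((-1 : ℤ) ^ (n₁ + n₂))) ∧
    -- the functional equation, away from the poles of the two gamma factors
    (∀ s : ℂ, (∀ k : ℕ, s ≠ 4 * k) → (∀ k : ℕ, s ≠ -(4 * (r + k))) →
      absZeta (bipartiteForm n₁ n₂) (-(4 * r) - s) ^ ((-1 : ℤ) ^ (n₁ + n₂)) =
        bipartiteEpsilon n₁ n₂ r s * absZeta (bipartiteForm n₁ n₂) s) := by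
  -- As `n₁ + n₂ = r + 2`, the sign in the statement is the parity sign of `r` that also occurs in
  -- the multiple sine.
  have hsign : (-1 : ℤ) ^ (n₁ + n₂) = (-1) ^ r := by rw [← hr, pow_add]; simp
  have hsignC : (-1 : ℂ) ^ (n₁ + n₂) = (-1) ^ r := by rw [← hr, pow_add]; simp
  have h4 : (0 : ℝ) < 4 := by norm_num
  have hm : 0 < 4 := by norm_num
  have hf := bipartiteForm_eq hn hr
  have hZ : absZeta (bipartiteForm n₁ n₂) = fun s : ℂ =>
      multipleGamma (s + 4 * r) (fun _ : Fin r => (4 : ℝ)) ^ ((-1 : ℤ) ^ r) := by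
    simpa only [Nat.cast_ofNat] using absZeta_eq hm hf
  have hshift : ∀ s : ℂ, -(4 * (r : ℝ)) < s.re → 0 < (s + 4 * r).re := by
    intro s hs
    simp
    linarith
  have hH : ∀ s : ℂ, -(4 * (r : ℝ)) < s.re → (fun w => absHurwitz (bipartiteForm n₁ n₂) w s) =
      fun w => (-1) ^ r * multipleHurwitz w (s + 4 * r) (fun _ : Fin r => (4 : ℝ)) := by
    intro s hs
    simpa only [Nat.cast_ofNat] using absHurwitz_eq hm hf (by simpa using hshift s hs)
  refine ⟨fun u hu => ?_, ?_, fun x hx => ⟨fun w hw => ⟨?_, ?_⟩, ?_, ?_, ?_⟩, ?_,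
    fun s hs => ⟨fun w hw => ⟨?_, ?_⟩, ?_, ?_, ?_⟩, ?_, fun s hs w => ?_, fun s => ?_,
    fun s hs1 hs2 => ?_⟩
  · have h1 : 1 - u ^ 4 = (-1) * (u ^ 4 - 1) := by ring
    rw [bipartiteGroverZeta_eq hn hr, hsignC, h1, mul_pow, mul_inv, ← inv_pow, inv_neg, inv_one,
      div_eq_mul_inv]
  · rw [hsign]
    exact_mod_cast isAbsoluteAutomorphicForm_inv_one_sub_pow hf
  · exact (hasSum_multipleHurwitzTerm h4 hx hw).summable
  · rw [multipleHurwitz_eq_mellin h4 hx hw]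
    exact (hasSum_multipleHurwitzTerm h4 hx hw).tsum_eq.symm
  · exact meromorphicNFOn_multipleHurwitz h4 r hx
  · exact analyticAt_multipleHurwitz_zero h4 r hx
  · exact multipleGamma_eq_exp h4 r hx
  · exact meromorphicNFOn_multipleGamma h4 r
  · exact integrableOn_absHurwitzIntegrand hm hf (by simpa using hshift s hs) hw
  · rw [congrFun (hH s hs) w, absHurwitzIntegral_eq hm hf (by simpa using hshift s hs) hw]
    simp only [Nat.cast_ofNat]
  · rw [hH s hs]
    exact meromorphicNFOn_const_mul (pow_ne_zero r (by norm_num))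
      (meromorphicNFOn_multipleHurwitz h4 r (hshift s hs))
  · rw [hH s hs]
    exact analyticAt_const.fun_mul (analyticAt_multipleHurwitz_zero h4 r (hshift s hs))
  · rw [exp_deriv_absHurwitz hm hf (by simpa using hshift s hs), hZ]
    simp only [Nat.cast_ofNat]
  · rw [hZ]
    exact meromorphicNFOn_multipleGamma_shift_zpow h4 r _ _
  · rw [congrFun (hH s hs) w, hsignC]
  · rw [hZ, hsign]
  · have hne : multipleGamma (s + 4 * r) (fun _ : Fin r => (4 : ℝ)) ≠ 0 := by
      refine multipleGamma_ne_zero h4 r fun k hk => hs2 k ?_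
      push_cast at hk
      linear_combination hk
    have h1 : -(4 * (r : ℂ)) - s + 4 * r = -s := by ring
    have h2 : (∑ _i : Fin r, ((4 : ℝ) : ℂ)) - (s + 4 * r) = -s := by
      simp
      ring
    have h3 : ((-1 : ℤ) ^ r) * (-1) ^ r = 1 := by rw [← mul_pow]; simp
    simp only [hZ, bipartiteEpsilon, multipleSine, hsign]
    rw [h1, h2, mul_zpow, ← zpow_mul, h3, mul_right_comm, ← mul_zpow, inv_mul_cancel₀ hne, one_zpow,
      one_mul]
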